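/- **Setting.** Let $(M,d)$ be a compact connected metric space whose distance is geodesic, i.e. any two points are joined by a curve realizing their distance (for instance a compact connected Riemannian manifold). Let $(X,\mathcal A,\mathbb P)$ be a probability space and $\theta:X\to X$ an invertible bimeasurable transformation that preserves $\mathbb P$ and is ergodic. For each $w\in X$ let $f_w:M\to M$ be a local homeomorphism, with $(w,x)\mapsto f_w(x)$ measurable; put $f^0_w=\mathrm{id}$, $f^n_w=f_{\theta^{n-1}(w)}\circ\cdots\circ f_{\theta(w)}\circ f_w$. Let $\deg(f_w)$ be the number of preimages of a point under $f_w$ (it does not depend on the point), and assume $\sup_w\deg(f_w)<\infty$. Fix $\delta>0$ and $\alpha>0$. Assume that for each $w$ there is a continuous function $L_w(\cdot):M\to\mathbb R$ such that every $x\in M$ has a neighbourhood $U_x$ on which $f_w$ is injective, with $B(f_w(x),\delta)\subset f_w(U_x)$, and on which $d(y,z)\le L_w(x)\,d(f_w(y),f_w(z))$ for all $y,z\in U_x$. Assume that for each $w$ there are an open set $\mathcal A_w\subset M$, constants $\sigma_w>1$ and $1\le L_w\le 2$, and an integer $0\le q_w<\deg(f_w)$ such that: (I) $L_w(x)\le L_w$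 for $x\in\mathcal A_w$ and $L_w(x)<\sigma_w^{-1}$ for $x\notin\mathcal A_w$; (II) there is a finite covering of $M$ by open sets on which $f_w$ is injective such that $\mathcal A_w$ is covered by at most $q_w$ of them; (III) for every $\varepsilon>0$ there is an integer $\tilde n=\tilde n(w,\varepsilon)\ge 1$ with $f^{\tilde n}_{\theta^j(w)}\big(B(f^j_w(x),\varepsilon)\big)=M$ for all $j\ge 0$ and $x\in M$. Write $|u|_\alpha$ for the $\alpha$-Hölder seminorm and $C^\alpha(M)$ for the space of $\alpha$-Hölder functions. Let $\phi:X\times M\to\mathbb R$ be measurable with $\phi_w=\phi(w,\cdot)\in C^\alpha(M)$ for all $w$ and $\int_X\|\phi_w\|_\infty\,d\mathbb P<\infty$. Assume that there is $\varepsilon_\phi>0$ such that, for all $w\in X$, (IV) $\sup\phi_w-\inf\phi_w+\varepsilon_\phi<\log\deg(f_w)-\log q_w$ (with $\log 0=-\infty$) and $|e^{\phi_w}|_\alpha<\varepsilon_\phi e^{\inf\phi_w}$. Let $m\ge1$ be a constant such that every function $u:M\to\mathbb R$ with $|u(x)-u(y)|\le C\,d(x,y)^\alpha$ whenever $d(x,y)<\delta$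 satisfies $|u(x)-u(y)|\le Cm\,d(x,y)^\alpha$ for all $x,y$. With $p_w=\deg(f_w)-q_w$, assume that there is $\gamma<1$ such that, for all $w\in X$, (V) $e^{\varepsilon_\phi}\,\dfrac{p_w\sigma_w^{-\alpha}+q_wL_w^\alpha\,(1+(L_w-1)^\alpha)}{\deg(f_w)}+\varepsilon_\phi L_w^\alpha\,\big[1+m(\operatorname{diam}M)^\alpha\big]\le\gamma.$ Let $\mathcal L_w\psi(x)=\sum_{y\in f_w^{-1}(x)}e^{\phi_w(y)}\psi(y)$. Let $\{\nu_w\}$ be a measurable family of Borel probabilities on $M$ with $\mathcal L_w^*\nu_{\theta(w)}=\lambda_w\nu_w$ for a.e. $w$, where $\lambda_w=\int\mathcal L_w1\,d\nu_{\theta(w)}$. Let $\{h_w\}$ be a measurable family of functions such that, for a.e. $w$, $h_w\in C^\alpha(M)$ is bounded away from zero and infinity, $\mathcal L_wh_w=\lambda_wh_{\theta(w)}$ and $\int h_w\,d\nu_w=1$. Put $\mu_w=h_w\nu_w$. **Theorem B.** The measures $\mu_w$ have exponential decay of correlations: there is $0<\tau<1$ such that for $\mathbb P$-almost every $w$ and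 every $\psi\in C^\alpha(M)$ there is a constant $K=K(w,\psi)>0$ such that, for all $n\ge1$ and all $\varphi\in L^1(\mu_{\theta^n(w)})$, the function $(\varphi\circ f_w^n)\,\psi$ is $\mu_w$-integrable and $$\left|\int(\varphi\circ f_w^n)\,\psi\,d\mu_w-\int\varphi\,d\mu_{\theta^n(w)}\int\psi\,d\mu_w\right|\le K\,\|\varphi\|_{L^1(\mu_{\theta^n(w)})}\,\tau^n .$$ -/

import Mathlib

open MeasureTheory ProbabilityTheory Set Topology
open scoped NNReal ENNReal

/-- A geodesic metric space: any two points are joined by a curve that realizes their distance.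
The Riemannian distance of a compact connected manifold has this property. -/
def IsGeodesicSpace (M : Type*) [MetricSpace M] : Prop :=
  ∀ x y : M, ∃ c : ℝ → M, c 0 = x ∧ c (dist x y) = y ∧
    ∀ s ∈ Icc (0 : ℝ) (dist x y), ∀ t ∈ Icc (0 : ℝ) (dist x y), dist (c s) (c t) = |s - t|

/-- The fiber iterates `f_w^n = f_{θ^{n-1}(w)} ∘ ⋯ ∘ f_{θ(w)} ∘ f_w`, with `f_w^0 = id`. -/
def fiberIter {X M : Type*} (θ : X → X) (f : X → M → M) : ℕ → X → M → M
  | 0, _ => id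
  | n + 1, w => f (θ^[n] w) ∘ fiberIter θ f n w

/-- The degree of `g`: the number of preimages of a point. For a local homeomorphism of a compact
connected space this number is the same for all points, and so equals the supremum. -/
noncomputable def mapDegree {M : Type*} (g : M → M) : ℕ :=
  ⨆ y : M, (g ⁻¹' {y}).ncard

/-- The transfer operator of the map `g` with the potential `u`:
`ψ ↦ (x ↦ ∑_{y ∈ g⁻¹(x)} e^{u(y)} ψ(y))`. -/
noncomputable def transferOp {M : Type*} (g : M → M) (u : M → ℝ) (ψ : M → ℝ) (x : M) : ℝ :=
  ∑ᶠ y ∈ g ⁻¹' {x}, Real.exp (u y) * ψ y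

/-- `u` is `(C, α)`-Hölder continuous in balls of radius `δ`. -/
def HolderInBalls {M : Type*} [MetricSpace M] (δ : ℝ) (C α : ℝ≥0) (u : M → ℝ) : Prop :=
  ∀ x : M, ∀ y ∈ Metric.ball x δ, |u x - u y| ≤ C * dist x y ^ (α : ℝ)

/-- The hypotheses on the generating maps `f_w`. Here `ℓ w x` is the Lipschitz constant of the
inverse branch of `f_w` at `x`, `A w` is the region where `f_w` may fail to expand, `L w` and
`(σ w)⁻¹` bound `ℓ w` on `A w` and off `A w`, and `δ` is a radius, the same for all `w`, of balls
on which the inverse branches are defined. -/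
structure GeneratingMaps {X M : Type*} [MeasurableSpace X] [MetricSpace M] [MeasurableSpace M]
    (θ : X → X) (f : X → M → M) (ℓ : X → M → ℝ) (A : X → Set M) (σ L : X → ℝ) (q : X → ℕ)
    (δ : ℝ) : Prop where
  measurable : Measurable (fun z : X × M => f z.1 z.2)
  isLocalHomeomorph : ∀ w, IsLocalHomeomorph (f w)
  continuous_lip : ∀ w, Continuous (ℓ w)
  inverse_branch : ∀ w x, ∃ U ∈ 𝓝 x, InjOn (f w) U ∧ Metric.ball (f w x) δ ⊆ f w '' U ∧
    ∀ y ∈ U, ∀ z ∈ U, dist y z ≤ ℓ w x * dist (f w y) (f w z)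
  degree_bdd : ∃ N : ℕ, ∀ w, mapDegree (f w) ≤ N
  isOpen_region : ∀ w, IsOpen (A w)
  one_lt_sigma : ∀ w, 1 < σ w
  one_le_L : ∀ w, 1 ≤ L w
  L_le_two : ∀ w, L w ≤ 2
  lip_on_region : ∀ w, ∀ x ∈ A w, ℓ w x ≤ L w
  lip_off_region : ∀ w, ∀ x ∉ A w, ℓ w x < (σ w)⁻¹
  covering : ∀ w, ∃ 𝒰 : Finset (Set M), (∀ U ∈ 𝒰, IsOpen U ∧ InjOn (f w) U) ∧
    (⋃ U ∈ 𝒰, U) = univ ∧ ∃ 𝒱 ⊆ 𝒰, 𝒱.card ≤ q w ∧ A w ⊆ ⋃ U ∈ 𝒱, U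
  q_lt_degree : ∀ w, q w < mapDegree (f w)
  exact : ∀ w, ∀ ε > (0 : ℝ), ∃ n : ℕ, 0 < n ∧ ∀ (j : ℕ) (x : M),
    fiberIter θ f n (θ^[j] w) '' Metric.ball (fiberIter θ f j w x) ε = univ

/-- The hypotheses on the potential: it belongs to `L¹_ℙ(X, C^α(M))` and has small variation, with
the constant `ε`. When `q w = 0` the bound `log (deg f_w) - log (q w)` is read as `+∞`. -/
structure SmallVariationPotential {X M : Type*} [MeasurableSpace X] [MetricSpace M]
    [MeasurableSpace M] (P : Measure X) (f : X → M → M) (q : X → ℕ) (α : ℝ≥0)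
    (φ : X → M → ℝ) (ε : ℝ) : Prop where
  measurable : Measurable (fun z : X × M => φ z.1 z.2)
  holder : ∀ w, MemHolder α (φ w)
  integrable : Integrable (fun w => ⨆ x, |φ w x|) P
  pos : 0 < ε
  variation : ∀ w, q w ≠ 0 →
    (⨆ x, φ w x) - (⨅ x, φ w x) + ε < Real.log (mapDegree (f w)) - Real.log (q w)
  seminorm_exp : ∀ w, (nnHolderNorm α (fun x => Real.exp (φ w x)) : ℝ) <
    ε * Real.exp (⨅ x, φ w x)

/-- The number `γ_w` that bounds the contraction of the cone of locally Hölder functions. -/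
noncomputable def coneRate {X M : Type*} [MetricSpace M] (f : X → M → M) (σ L : X → ℝ)
    (q : X → ℕ) (α : ℝ≥0) (ε m : ℝ) (w : X) : ℝ :=
  Real.exp ε *
      ((((mapDegree (f w) : ℝ) - q w) * σ w ^ (-(α : ℝ)) +
        q w * L w ^ (α : ℝ) * (1 + (L w - 1) ^ (α : ℝ))) / mapDegree (f w)) +
    ε * L w ^ (α : ℝ) * (1 + m * Metric.diam (univ : Set M) ^ (α : ℝ))

/-- `λ_w = ν_{θ(w)}(𝓛_w 1)`. -/
noncomputable def eigenvalue {X M : Type*} [MeasurableSpace X] [MeasurableSpace M] (θ : X → X)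
    (f : X → M → M) (φ : X → M → ℝ) (ν : Kernel X M) (w : X) : ℝ :=
  ∫ x, transferOp (f w) (φ w) (fun _ => 1) x ∂(ν (θ w))

/-- The measurable family of probabilities `ν` is a family of reference measures:
`𝓛_w^* ν_{θ(w)} = λ_w ν_w` for almost every `w`. -/
def IsReferenceFamily {X M : Type*} [MeasurableSpace X] [MetricSpace M] [MeasurableSpace M]
    (P : Measure X) (θ : X → X) (f : X → M → M) (φ : X → M → ℝ) (ν : Kernel X M) : Prop :=
  IsMarkovKernel ν ∧ ∀ᵐ w ∂P, ∀ ψ : M → ℝ, Continuous ψ →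
    ∫ x, transferOp (f w) (φ w) ψ x ∂(ν (θ w)) = eigenvalue θ f φ ν w * ∫ x, ψ x ∂(ν w)

/-- `h` is a measurable family of Hölder continuous functions, bounded away from zero and infinity,
with `𝓛_w h_w = λ_w h_{θ(w)}` and `ν_w(h_w) = 1` for almost every `w`. -/
def IsInvariantDensity {X M : Type*} [MeasurableSpace X] [MetricSpace M] [MeasurableSpace M]
    (P : Measure X) (θ : X → X) (f : X → M → M) (φ : X → M → ℝ) (α : ℝ≥0) (ν : Kernel X M)
    (h : X → M → ℝ) : Prop :=
  Measurable (fun z : X × M => h z.1 z.2) ∧ ∀ᵐ w ∂P,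
    MemHolder α (h w) ∧ (∃ c C : ℝ, 0 < c ∧ ∀ x, c ≤ h w x ∧ h w x ≤ C) ∧
    (∀ x, transferOp (f w) (φ w) (h w) x = eigenvalue θ f φ ν w * h (θ w) x) ∧
    ∫ x, h w x ∂(ν w) = 1

/-- The fiber measure `μ_w = h_w ν_w`. -/
noncomputable def fiberMeasure {X M : Type*} [MeasurableSpace X] [MeasurableSpace M]
    (ν : Kernel X M) (h : X → M → ℝ) (w : X) : Measure M :=
  (ν w).withDensity (fun x => ENNReal.ofReal (h w x))

/-! Let T_w be the transfer operator divided by λ_w. It preserves integrals, from ν_w to ν_{θ(w)};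
its iterates take h_w to h_{θ^n(w)}; and the push-forward of u ν_w under f_w^n has density T^n u
with respect to ν_{θ^n(w)} (`map_fiberIter_withDensity`). With u = h_w ψ, the correlation is
therefore the integral of (T^n u - (∫ u dν_w) h_{θ^n(w)}) φ against ν_{θ^n(w)}. If the bracket is at
most K τ^n h_{θ^n(w)} pointwise, integration against |φ| produces exactly the norm of φ in
L¹(μ_{θ^n(w)}). This pointwise bound is `MixingOperators.exists_rate`.

It comes from a Doeblin argument on the nonnegative functions of integral one with local Hölder
constant κ; no projective metric is involved. Three facts feed it. Inverse branches pair the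
preimages of nearby points, and condition (V) makes the average contraction over the pairs beat the
distortion of the potential: T turns a Hölder constant C and a sup bound S into the Hölder constant
γ(C + S) (`abs_transferOp_sub_le`). Ergodicity makes the time of topological exactness at each scale
the same almost everywhere (`GeneratingMaps.exists_uniform_exact`). Finally u(y) ≤ B · T u(f y) with
a uniform B, since the degrees are bounded.

By the last two facts, the values of u near one point bound a later iterate from below on all of M.
Integrated, this bounds sup u and makes the cone invariant for large κ (`exists_cone_bound`); used
at a point where u ≥ 1, it gives a uniform positive lower bound (`exists_cone_lower`). Hence after a
fixed time a constant η splits off and the remainder, rescaled, is again in the cone. The constants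
cancel in the difference of two densities, which shrinks by the factor 1 - η (`exists_contraction`).
-/

/-! ### Inverse branches and the degree. -/

section InverseBranches

variable {M : Type*} [MetricSpace M]

/-- The inverse branches of a local homeomorphism over a ball match the fibers of nearby points. -/
theorem exists_fiber_matching (hM : IsGeodesicSpace M) {g : M → M} (hg : IsLocalHomeomorph g)
    {l : M → ℝ} {δ : ℝ}
    (hb : ∀ x, ∃ U ∈ 𝓝 x, InjOn g U ∧ Metric.ball (g x) δ ⊆ g '' U ∧
      ∀ y ∈ U, ∀ z ∈ U, dist y z ≤ l x * dist (g y) (g z))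
    {x y : M} (hxy : dist x y < δ) :
    ∃ b : M → M, MapsTo b (g ⁻¹' {x}) (g ⁻¹' {y}) ∧ InjOn b (g ⁻¹' {x}) ∧
      ∀ a ∈ g ⁻¹' {x}, dist a (b a) ≤ l a * dist x y := by
  have hδ : 0 < δ := dist_nonneg.trans_lt hxy
  choose U hU hinj hsub hlip using hb
  have hex : ∀ a p, ∃ z, p ∈ Metric.ball (g a) δ → z ∈ U a ∧ g z = p := by
    intro a p
    by_cases hp : p ∈ Metric.ball (g a) δ
    · obtain ⟨z, hz, hz'⟩ := hsub a hp
      exact ⟨z, fun _ => ⟨hz, hz'⟩⟩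
    · exact ⟨a, fun h => absurd h hp⟩
  choose s hs using hex
  have hself : ∀ a, s a (g a) = a := fun a =>
    hinj a (hs a _ (Metric.mem_ball_self hδ)).1 (mem_of_mem_nhds (hU a))
      (hs a _ (Metric.mem_ball_self hδ)).2
  have hsl : ∀ a, ∀ p ∈ Metric.ball (g a) δ, ∀ p' ∈ Metric.ball (g a) δ,
      dist (s a p) (s a p') ≤ l a * dist p p' := by
    intro a p hp p' hp'
    have := hlip a _ (hs a p hp).1 _ (hs a p' hp').1
    rwa [(hs a p hp).2, (hs a p' hp').2] at this
  have hcont : ∀ a, ContinuousOn (s a) (Metric.ball (g a) δ) := by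
    intro a
    refine (LipschitzOnWith.of_dist_le_mul (K := (l a).toNNReal) fun p hp p' hp' =>
      (hsl a p hp p' hp').trans ?_).continuousOn
    exact mul_le_mul_of_nonneg_right (Real.le_coe_toNNReal _) dist_nonneg
  obtain ⟨c, hc0, hc1, hc⟩ := hM x y
  have h0 : (0 : ℝ) ∈ Icc (0 : ℝ) (dist x y) := ⟨le_rfl, dist_nonneg⟩
  have h1 : dist x y ∈ Icc (0 : ℝ) (dist x y) := ⟨dist_nonneg, le_rfl⟩
  have hcball : MapsTo c (Icc 0 (dist x y)) (Metric.ball x δ) := by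
    intro t ht
    rw [Metric.mem_ball, ← hc0, hc t ht 0 h0, sub_zero, abs_of_nonneg ht.1]
    exact ht.2.trans_lt hxy
  have hccont : ContinuousOn c (Icc 0 (dist x y)) := by
    refine (LipschitzOnWith.of_dist_le_mul (K := 1) fun t ht t' ht' => ?_).continuousOn
    rw [hc t ht t' ht', Real.dist_eq]
    simp
  have hy : y ∈ Metric.ball x δ := by rwa [Metric.mem_ball, dist_comm]
  refine ⟨fun a => s a y, ?_, ?_, ?_⟩
  · rintro a rfl
    exact (hs a y hy).2
  · intro a ha a' ha' heq
    have ha : g a = x := ha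
    have ha' : g a' = x := ha'
    -- Two branches that meet over `y` are lifts of the same geodesic; by uniqueness of lifts they
    -- agree along it, hence also over `x`.
    have key : EqOn (s a ∘ c) (s a' ∘ c) (Icc 0 (dist x y)) := by
      refine IsSeparatedMap.eqOn_of_comp_eqOn (p := g) (T2Space.isSeparatedMap g)
        hg.isLocallyInjective isPreconnected_Icc
        ((hcont a).comp hccont (by rwa [ha])) ((hcont a').comp hccont (by rwa [ha'])) ?_ h1
        (by simpa [hc1] using heq)
      intro t ht
      simp only [Function.comp]
      rw [(hs a _ (by rw [ha]; exact hcball ht)).2, (hs a' _ (by rw [ha']; exact hcball ht)).2]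
    have := key h0
    simp only [Function.comp, hc0] at this
    rwa [← ha, hself, ha, ← ha', hself] at this
  · rintro a rfl
    have := hsl a (g a) (Metric.mem_ball_self hδ) y hy
    rwa [hself] at this

/-- An infinite fiber would accumulate at one of its own points, against local injectivity. Without
finiteness both `ncard` and the `finsum` in `transferOp` could take the default value 0. -/
theorem IsLocalHomeomorph.finite_fiber [CompactSpace M] {g : M → M} (hg : IsLocalHomeomorph g)
    (x : M) : (g ⁻¹' {x}).Finite := by
  by_contra hinf
  have hcl : IsClosed (g ⁻¹' {x}) := isClosed_singleton.preimage hg.continuous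
  obtain ⟨p, hp, hacc⟩ := Set.Infinite.exists_accPt_of_subset_isCompact hinf hcl.isCompact
    subset_rfl
  obtain ⟨V, hVo, hpV, hV⟩ := hg.isLocallyInjective p
  obtain ⟨y, ⟨hyV, hyx⟩, hne⟩ := accPt_iff_nhds.1 hacc V (hVo.mem_nhds hpV)
  exact hne (hV hyV hpV ((mem_preimage.1 hyx).trans (mem_preimage.1 hp).symm))

/-- The matching of fibers is injective in both directions, so the cardinality is locally constant,
and M is connected. -/
theorem ncard_fiber_eq_mapDegree [CompactSpace M] [ConnectedSpace M] (hM : IsGeodesicSpace M)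
    {g : M → M} (hg : IsLocalHomeomorph g) {l : M → ℝ} {δ : ℝ} (hδ : 0 < δ)
    (hb : ∀ x, ∃ U ∈ 𝓝 x, InjOn g U ∧ Metric.ball (g x) δ ⊆ g '' U ∧
      ∀ y ∈ U, ∀ z ∈ U, dist y z ≤ l x * dist (g y) (g z)) (x : M) :
    (g ⁻¹' {x}).ncard = mapDegree g := by
  have hle : ∀ x y, dist x y < δ → (g ⁻¹' {x}).ncard ≤ (g ⁻¹' {y}).ncard := by
    intro x y hxy
    obtain ⟨b, hb1, hb2, -⟩ := exists_fiber_matching hM hg hb hxy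
    exact ncard_le_ncard_of_injOn b hb1 hb2 (hg.finite_fiber y)
  have hloc : IsLocallyConstant fun x => (g ⁻¹' {x}).ncard := by
    rw [IsLocallyConstant.iff_eventually_eq]
    intro x
    filter_upwards [Metric.ball_mem_nhds x hδ] with y hy
    exact le_antisymm (hle y x hy) (hle x y (by rwa [dist_comm]))
  have hconst : ∀ y, (g ⁻¹' {y}).ncard = (g ⁻¹' {x}).ncard := fun y =>
    hloc.apply_eq_of_isPreconnected isPreconnected_univ (mem_univ y) (mem_univ x)
  have : Nonempty M := ⟨x⟩
  simp only [mapDegree, hconst, ciSup_const]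

end InverseBranches

/-! ### Functions that are Hölder in balls. -/

section HolderInBalls

variable {M : Type*} [MetricSpace M] {δ : ℝ} {C C' α : ℝ≥0} {u v : M → ℝ}

theorem HolderWith.holderInBalls (hu : HolderWith C α u) (δ : ℝ) : HolderInBalls δ C α u :=
  fun x y _ => by simpa [Real.dist_eq] using hu.dist_le x y

theorem HolderInBalls.mono (hu : HolderInBalls δ C α u) (h : C ≤ C') : HolderInBalls δ C' α u :=
  fun x y hy => (hu x y hy).trans (by gcongr)

theorem HolderInBalls.affine (hu : HolderInBalls δ C α u) (c : ℝ) (r : ℝ≥0) :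
    HolderInBalls δ (r * C) α (fun x => r * (u x + c)) := fun x y hy => by
  have := hu x y hy
  have h2 : (r : ℝ) * (u x + c) - r * (u y + c) = r * (u x - u y) := by ring
  rw [h2, abs_mul, abs_of_nonneg r.coe_nonneg, NNReal.coe_mul, mul_assoc]
  gcongr

theorem HolderInBalls.continuous (hδ : 0 < δ) (hα : 0 < α) (hu : HolderInBalls δ C α u) :
    Continuous u := by
  rw [continuous_iff_continuousAt]
  intro x
  rw [ContinuousAt, tendsto_iff_dist_tendsto_zero]
  have hα' : (0 : ℝ) < α := hα
  have hlim : Filter.Tendsto (fun y => (C : ℝ) * dist x y ^ (α : ℝ)) (𝓝 x) (𝓝 0) := by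
    have : Continuous fun y => (C : ℝ) * dist x y ^ (α : ℝ) :=
      continuous_const.mul ((continuous_const.dist continuous_id).rpow_const
        fun _ => Or.inr hα'.le)
    simpa [Real.zero_rpow hα'.ne'] using this.tendsto x
  refine squeeze_zero' (Filter.Eventually.of_forall fun _ => dist_nonneg) ?_ hlim
  filter_upwards [Metric.ball_mem_nhds x hδ] with y hy
  rw [dist_comm, Real.dist_eq]
  exact hu x y hy

theorem exists_abs_le_of_continuous [CompactSpace M] (hu : Continuous u) :
    ∃ R : ℝ≥0, ∀ x, |u x| ≤ R := by
  obtain ⟨R, hR⟩ := isCompact_univ.exists_bound_of_continuousOn hu.continuousOn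
  exact ⟨R.toNNReal, fun x => (hR x (mem_univ x)).trans (Real.le_coe_toNNReal R)⟩

theorem HolderInBalls.mul {R S : ℝ≥0} (hu : HolderInBalls δ C α u) (hv : HolderInBalls δ C' α v)
    (hR : ∀ x, |u x| ≤ R) (hS : ∀ x, |v x| ≤ S) :
    HolderInBalls δ (R * C' + C * S) α (fun x => u x * v x) := fun x y hy => by
  have h2 : u x * v x - u y * v y = u x * (v x - v y) + (u x - u y) * v y := by ring
  rw [h2]
  refine (abs_add_le _ _).trans ?_
  rw [abs_mul, abs_mul]
  push_cast
  calc |u x| * |v x - v y| + |u x - u y| * |v y|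
      ≤ R * (C' * dist x y ^ (α : ℝ)) + C * dist x y ^ (α : ℝ) * S := by
        gcongr
        · exact hR x
        · exact hv x y hy
        · exact hu x y hy
        · exact hS y
    _ = _ := by ring

/-- The exponential is Lipschitz on half-lines bounded above. This is needed because `nnHolderNorm`
is 0 for a function that is not Hölder, so a bound on it says nothing by itself. -/
theorem MemHolder.exp [CompactSpace M] (hα : 0 < α) (hu : MemHolder α u) :
    MemHolder α (fun x => Real.exp (u x)) := by
  obtain ⟨R, hR⟩ := exists_abs_le_of_continuous (hu.holderWith.continuous hα)
  have hexp : ∀ a b : ℝ, a ≤ R → Real.exp a - Real.exp b ≤ Real.exp R * |a - b| := by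
    intro a b ha
    have h1 : Real.exp b = Real.exp a * Real.exp (b - a) := by rw [← Real.exp_add]; congr 1; ring
    have h2 := Real.add_one_le_exp (b - a)
    have h3 : Real.exp a * (a - b) ≤ Real.exp R * |a - b| :=
      (mul_le_mul_of_nonneg_left (le_abs_self _) (Real.exp_pos a).le).trans
        (mul_le_mul_of_nonneg_right (Real.exp_le_exp.2 ha) (abs_nonneg _))
    nlinarith [Real.exp_pos a]
  have hlip : LipschitzOnWith (Real.exp R).toNNReal Real.exp (Iic (R : ℝ)) := by
    refine LipschitzOnWith.of_dist_le_mul fun a ha b hb => ?_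
    rw [Real.coe_toNNReal _ (Real.exp_pos _).le, Real.dist_eq, Real.dist_eq, abs_le']
    refine ⟨hexp a b ha, ?_⟩
    rw [neg_sub, abs_sub_comm a b]
    exact hexp b a hb
  have := (holderOnWith_one.2 hlip).comp (hu.holderWith.holderOnWith univ)
    (fun x _ => (le_abs_self _).trans (hR x))
  rw [one_mul] at this
  exact (holderOnWith_univ.1 this).memHolder

end HolderInBalls

/-! ### Transfer operators as finite sums, and displacements longer than the distance of the images.
-/

section TransferOperator

variable {M : Type*}

theorem transferOp_eq_sum {g : M → M} {x : M} (h : (g ⁻¹' {x}).Finite) (u ψ : M → ℝ) :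
    transferOp g u ψ x = ∑ y ∈ h.toFinset, Real.exp (u y) * ψ y :=
  finsum_mem_eq_finite_toFinset_sum _ h

theorem le_transferOp {g : M → M} {y : M} (h : (g ⁻¹' {g y}).Finite) (u : M → ℝ) {ψ : M → ℝ}
    (hψ : ∀ z, 0 ≤ ψ z) : Real.exp (u y) * ψ y ≤ transferOp g u ψ (g y) := by
  rw [transferOp_eq_sum h]
  exact Finset.single_le_sum (f := fun y => Real.exp (u y) * ψ y)
    (fun z _ => mul_nonneg (Real.exp_pos _).le (hψ z)) (by simp)

theorem transferOp_comp_mul {g : M → M} (hfin : ∀ x, (g ⁻¹' {x}).Finite) (u G ψ : M → ℝ) (x : M) :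
    transferOp g u (fun y => G (g y) * ψ y) x = G x * transferOp g u ψ x := by
  rw [transferOp_eq_sum (hfin x), transferOp_eq_sum (hfin x), Finset.mul_sum]
  refine Finset.sum_congr rfl fun y hy => ?_
  rw [Set.Finite.mem_toFinset, mem_preimage, mem_singleton_iff] at hy
  rw [hy]
  ring

theorem transferOp_one_mem_Icc {g : M → M} {x : M} {a b : ℝ} {u : M → ℝ}
    (h : (g ⁻¹' {x}).Finite) (hu : ∀ y, Real.exp (u y) ∈ Icc a b) :
    transferOp g u (fun _ => 1) x ∈ Icc ((g ⁻¹' {x}).ncard * a) ((g ⁻¹' {x}).ncard * b) := by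
  rw [transferOp_eq_sum h, ncard_eq_toFinset_card _ h]
  simp only [mul_one]
  rw [← nsmul_eq_mul, ← nsmul_eq_mul]
  exact ⟨Finset.card_nsmul_le_sum _ _ _ fun y _ => (hu y).1,
    Finset.sum_le_card_nsmul _ _ _ fun y _ => (hu y).2⟩

/-- An estimate for the increments of a function along a displacement of length at most `L d`
with `L ≤ 2`, obtained by stopping at distance `d` on a geodesic. -/
theorem HolderInBalls.abs_sub_le_of_dist_le_mul [MetricSpace M] (hM : IsGeodesicSpace M) {δ : ℝ} {C α : ℝ≥0}
    (hα : 0 < α) {u : M → ℝ} (hu : HolderInBalls δ C α u) {a b : M} {L d : ℝ} (hL : 1 ≤ L)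
    (hL2 : L ≤ 2) (hd : d < δ) (hd0 : 0 ≤ d) (hab : dist a b ≤ L * d) :
    |u a - u b| ≤ C * ((1 + (L - 1) ^ (α : ℝ)) * d ^ (α : ℝ)) := by
  have hα' : (0 : ℝ) < α := hα
  have hL1 : 0 ≤ L - 1 := by linarith
  have hnn : 0 ≤ (L - 1) ^ (α : ℝ) * d ^ (α : ℝ) := by positivity
  rcases le_total (dist a b) d with hle | hle
  · have h1 := hu a b (by rw [Metric.mem_ball, dist_comm]; linarith)
    have h2 : dist a b ^ (α : ℝ) ≤ d ^ (α : ℝ) := by gcongr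
    have h3 : dist a b ^ (α : ℝ) ≤ (1 + (L - 1) ^ (α : ℝ)) * d ^ (α : ℝ) := by linarith
    exact h1.trans (by gcongr)
  · obtain ⟨c, hc0, hc1, hc⟩ := hM a b
    have m0 : (0 : ℝ) ∈ Icc (0 : ℝ) (dist a b) := ⟨le_rfl, dist_nonneg⟩
    have m1 : dist a b ∈ Icc (0 : ℝ) (dist a b) := ⟨dist_nonneg, le_rfl⟩
    have md : d ∈ Icc (0 : ℝ) (dist a b) := ⟨hd0, hle⟩
    have e1 : dist a (c d) = d := by
      have := hc 0 m0 d md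
      rwa [hc0, zero_sub, abs_neg, abs_of_nonneg hd0] at this
    have e2 : dist (c d) b = dist a b - d := by
      have := hc d md _ m1
      rwa [hc1, abs_sub_comm, abs_of_nonneg (by linarith)] at this
    have e3 : dist (c d) b ≤ (L - 1) * d := by linarith
    -- Here `L ≤ 2` enters: the second piece of the geodesic is also shorter than `δ`.
    have e4 : (L - 1) * d ≤ d := by nlinarith
    have h1 := hu a (c d) (by rw [Metric.mem_ball, dist_comm]; linarith)
    have h2 := hu (c d) b (by rw [Metric.mem_ball, dist_comm]; linarith)
    have h3 : dist (c d) b ^ (α : ℝ) ≤ (L - 1) ^ (α : ℝ) * d ^ (α : ℝ) := by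
      rw [← Real.mul_rpow hL1 hd0]
      gcongr
    have h4 : (C : ℝ) * dist (c d) b ^ (α : ℝ) ≤ C * ((L - 1) ^ (α : ℝ) * d ^ (α : ℝ)) := by gcongr
    rw [e1] at h1
    calc |u a - u b| ≤ |u a - u (c d)| + |u (c d) - u b| := abs_sub_le _ _ _
      _ ≤ _ := by linarith

/-- The number of preimages in a set that is covered by `n` domains of injectivity. -/
theorem card_filter_fiber_le {g : M → M} {x : M} (h : (g ⁻¹' {x}).Finite) {A : Set M}
    {𝒱 : Finset (Set M)} (h𝒱 : ∀ U ∈ 𝒱, InjOn g U) (hA : A ⊆ ⋃ U ∈ 𝒱, U)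
    [DecidablePred (· ∈ A)] : (h.toFinset.filter (· ∈ A)).card ≤ 𝒱.card := by
  have hex : ∀ a, ∃ U, a ∈ A → U ∈ 𝒱 ∧ a ∈ U := by
    intro a
    by_cases ha : a ∈ A
    · obtain ⟨U, hU, haU⟩ := mem_iUnion₂.1 (hA ha)
      exact ⟨U, fun _ => ⟨hU, haU⟩⟩
    · exact ⟨∅, fun h => absurd h ha⟩
  choose V hV using hex
  refine Finset.card_le_card_of_injOn V (fun a ha => ?_) fun a ha b hb hab => ?_
  · exact (hV a (Finset.mem_filter.1 ha).2).1
  · simp only [Finset.coe_filter, Set.Finite.mem_toFinset, mem_preimage, mem_singleton_iff,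
      mem_ofPred_eq] at ha hb
    refine h𝒱 _ (hV a ha.2).1 (hV a ha.2).2 ?_ (ha.1.trans hb.1.symm)
    rw [hab]
    exact (hV b hb.2).2

end TransferOperator

/-! ### First consequences of the hypotheses on maps and potential. -/

section Generating

variable {X M : Type*} [MeasurableSpace X] [MetricSpace M] [CompactSpace M]
  [MeasurableSpace M] {P : Measure X} {θ : X → X} {f : X → M → M} {ℓ : X → M → ℝ} {A : X → Set M}
  {σ L : X → ℝ} {q : X → ℕ} {δ : ℝ} {α : ℝ≥0} {φ : X → M → ℝ} {ε : ℝ}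

theorem GeneratingMaps.ncard_fiber [ConnectedSpace M] (hf : GeneratingMaps θ f ℓ A σ L q δ)
    (hM : IsGeodesicSpace M) (hδ : 0 < δ) (w : X) (x : M) : (f w ⁻¹' {x}).ncard = mapDegree (f w) :=
  ncard_fiber_eq_mapDegree hM (hf.isLocalHomeomorph w) hδ (hf.inverse_branch w) x

theorem GeneratingMaps.finite_fiber (hf : GeneratingMaps θ f ℓ A σ L q δ) (w : X) (x : M) :
    (f w ⁻¹' {x}).Finite := (hf.isLocalHomeomorph w).finite_fiber x

theorem GeneratingMaps.surjective [ConnectedSpace M] (hf : GeneratingMaps θ f ℓ A σ L q δ)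
    (hM : IsGeodesicSpace M) (hδ : 0 < δ) (w : X) : Function.Surjective (f w) := by
  intro x
  have h1 := hf.ncard_fiber hM hδ w x
  have h2 := hf.q_lt_degree w
  obtain ⟨y, hy⟩ := nonempty_of_ncard_ne_zero (s := f w ⁻¹' {x}) (by omega)
  exact ⟨y, hy⟩

theorem SmallVariationPotential.exp_sub_le (hφ : SmallVariationPotential P f q α φ ε) (hα : 0 < α)
    (w : X) (y z : M) : |Real.exp (φ w y) - Real.exp (φ w z)| ≤
      ε * Real.exp (⨅ x, φ w x) * dist y z ^ (α : ℝ) := by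
  have := ((hφ.holder w).exp hα).holderWith.dist_le y z
  rw [Real.dist_eq] at this
  exact this.trans (by gcongr; exact (hφ.seminorm_exp w).le)

/-- Compare the value at `y` with the value at a minimum point of `φ w`, using the seminorm bound
over the diameter. -/
theorem SmallVariationPotential.exp_mem_Icc (hφ : SmallVariationPotential P f q α φ ε) (hα : 0 < α)
    (w : X) (y : M) : Real.exp (φ w y) ∈ Icc (Real.exp (⨅ x, φ w x))
      (Real.exp (⨅ x, φ w x) * (1 + ε * Metric.diam (univ : Set M) ^ (α : ℝ))) := by
  have hcont : Continuous (φ w) := (hφ.holder w).holderWith.continuous hα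
  have hbdd : BddBelow (range (φ w)) := (isCompact_range hcont).bddBelow
  refine ⟨Real.exp_le_exp.2 (ciInf_le hbdd y), ?_⟩
  have : Nonempty M := ⟨y⟩
  obtain ⟨z, -, hz⟩ := isCompact_univ.exists_isMinOn univ_nonempty hcont.continuousOn
  have hz' : φ w z = ⨅ x, φ w x :=
    le_antisymm (le_ciInf fun x => hz (mem_univ x)) (ciInf_le hbdd z)
  have h1 := (abs_le.1 (hφ.exp_sub_le hα w y z)).2
  have h2 : dist y z ^ (α : ℝ) ≤ Metric.diam (univ : Set M) ^ (α : ℝ) := by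
    gcongr
    exact Metric.dist_le_diam_of_mem isCompact_univ.isBounded (mem_univ y) (mem_univ z)
  have h3 := hφ.pos
  have h4 : ε * Real.exp (⨅ x, φ w x) * dist y z ^ (α : ℝ) ≤
    ε * Real.exp (⨅ x, φ w x) * Metric.diam (univ : Set M) ^ (α : ℝ) := by gcongr
  rw [hz'] at h1
  linarith

end Generating

/-! ### The Lasota-Yorke inequality. -/

section LasotaYorke

variable {X M : Type*} [MeasurableSpace X] [MetricSpace M]
  [MeasurableSpace M] {P : Measure X} {θ : X → X} {f : X → M → M} {ℓ : X → M → ℝ} {A : X → Set M}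
  {σ L : X → ℝ} {q : X → ℕ} {δ : ℝ} {α : ℝ≥0} {φ : X → M → ℝ} {ε : ℝ} {m : ℝ≥0} {γ : ℝ}

/-- The contraction rates for the Hölder seminorm, for the distortion of the potential, and for
its variation over `M` that follow from the bound on `coneRate`. -/
theorem GeneratingMaps.rates_le (hf : GeneratingMaps θ f ℓ A σ L q δ) (hε : 0 < ε) (hm : 1 ≤ m)
    (hγ : γ < 1) {w : X} (hcone : coneRate f σ L q α ε m w ≤ γ) :
    (1 + ε * Metric.diam (univ : Set M) ^ (α : ℝ)) *
      (((mapDegree (f w) : ℝ) - q w) * σ w ^ (-(α : ℝ)) + q w * (1 + (L w - 1) ^ (α : ℝ))) ≤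
        mapDegree (f w) * γ ∧
    ε * L w ^ (α : ℝ) ≤ γ ∧ ε * Metric.diam (univ : Set M) ^ (α : ℝ) ≤ γ := by
  have hα0 : (0 : ℝ) ≤ α := α.coe_nonneg
  have hd : (0 : ℝ) < mapDegree (f w) := by
    have := hf.q_lt_degree w
    exact_mod_cast (by omega : 0 < mapDegree (f w))
  have hqd : (0 : ℝ) ≤ (mapDegree (f w) : ℝ) - q w := by
    have : (q w : ℝ) < mapDegree (f w) := by exact_mod_cast hf.q_lt_degree w
    linarith
  have hL1 := hf.one_le_L w
  have hσ := hf.one_lt_sigma w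
  have hm' : (1 : ℝ) ≤ m := hm
  have hL : 1 ≤ L w ^ (α : ℝ) := Real.one_le_rpow hL1 hα0
  have hl : 0 ≤ (L w - 1) ^ (α : ℝ) := Real.rpow_nonneg (by linarith) _
  have hs : 0 ≤ σ w ^ (-(α : ℝ)) := Real.rpow_nonneg (by linarith) _
  have hD : 0 ≤ Metric.diam (univ : Set M) ^ (α : ℝ) := Real.rpow_nonneg Metric.diam_nonneg _
  unfold coneRate at hcone
  set D := Metric.diam (univ : Set M) ^ (α : ℝ)
  set d : ℝ := (mapDegree (f w) : ℝ)
  set Lα := L w ^ (α : ℝ)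
  set l := (L w - 1) ^ (α : ℝ)
  set s := σ w ^ (-(α : ℝ))
  have hq : (0 : ℝ) ≤ q w := Nat.cast_nonneg _
  have hβ : ((d - q w) * s + q w * (1 + l)) / d ≤
      Real.exp ε * (((d - q w) * s + q w * Lα * (1 + l)) / d) := by
    have h1 : ((d - q w) * s + q w * (1 + l)) / d ≤ ((d - q w) * s + q w * Lα * (1 + l)) / d := by
      gcongr
      nlinarith
    have h2 : 0 ≤ ((d - q w) * s + q w * Lα * (1 + l)) / d := by positivity
    have h3 : 1 ≤ Real.exp ε := Real.one_le_exp hε.le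
    nlinarith
  have hβ0 : 0 ≤ ((d - q w) * s + q w * (1 + l)) / d := by positivity
  set β := ((d - q w) * s + q w * (1 + l)) / d with hβdef
  have hβd : (d - q w) * s + q w * (1 + l) = d * β := by rw [hβdef]; field_simp
  have h1 : D ≤ Lα * (m * D) := by
    have : D ≤ m * D := by nlinarith
    nlinarith
  have h2 : ε * D ≤ ε * (Lα * (m * D)) := by gcongr
  have h3 : 0 ≤ ε * D := by positivity
  have h4 : 0 ≤ ε * Lα := by positivity
  -- Condition (V) thus leaves room for three terms at once. The slack `ε * D` pays for the factor
  -- `1 + ε * D` in front of `β`, because `γ < 1`.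
  have h5 : β + ε * Lα + ε * D ≤ γ := by nlinarith
  refine ⟨?_, by linarith, by linarith⟩
  rw [hβd]
  have h6 : (1 + ε * D) * β ≤ γ := by
    have : (1 + ε * D) * β ≤ (1 + ε * D) * (γ - ε * D) := by gcongr; linarith
    nlinarith
  nlinarith

variable [CompactSpace M] [ConnectedSpace M]

/-- The Lasota-Yorke inequality for the transfer operators of the family. -/
theorem abs_transferOp_sub_le (hM : IsGeodesicSpace M) (hδ : 0 < δ)
    (hf : GeneratingMaps θ f ℓ A σ L q δ) (hα : 0 < α)
    (hφ : SmallVariationPotential P f q α φ ε) (hm : 1 ≤ m) (hγ : γ < 1) {w : X}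
    (hcone : coneRate f σ L q α ε m w ≤ γ) {C S : ℝ≥0} {ψ : M → ℝ}
    (hψ : HolderInBalls δ C α ψ) (hS : ∀ x, |ψ x| ≤ S) {x y : M} (hy : y ∈ Metric.ball x δ) :
    |transferOp (f w) (φ w) ψ x - transferOp (f w) (φ w) ψ y| ≤
      mapDegree (f w) * Real.exp (⨅ x, φ w x) * (γ * (C + S)) * dist x y ^ (α : ℝ) := by
  classical
  have hα' : (0 : ℝ) < α := hα
  obtain ⟨r1, r2, r3⟩ := hf.rates_le (α := α) hφ.pos hm hγ hcone
  have hxy : dist x y < δ := by rwa [Metric.mem_ball, dist_comm] at hy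
  obtain ⟨b, hb1, hb2, hb3⟩ := exists_fiber_matching hM (hf.isLocalHomeomorph w)
    (hf.inverse_branch w) hxy
  have hx := hf.finite_fiber w x
  have hyf := hf.finite_fiber w y
  have hcard : ∀ z (hz : (f w ⁻¹' {z}).Finite), hz.toFinset.card = mapDegree (f w) := fun z hz => by
    rw [← ncard_eq_toFinset_card _ hz, hf.ncard_fiber hM hδ]
  -- The matching is injective between fibers of equal cardinality, hence bijective, and reindexes
  -- the sum over the fiber of `y`.
  have hsum : transferOp (f w) (φ w) ψ y =
      ∑ a ∈ hx.toFinset, Real.exp (φ w (b a)) * ψ (b a) := by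
    rw [transferOp_eq_sum hyf]
    symm
    have hmap : ∀ a ∈ hx.toFinset, b a ∈ hyf.toFinset := fun a ha => by
      rw [Set.Finite.mem_toFinset] at ha ⊢
      exact hb1 ha
    have hinj : InjOn b (hx.toFinset : Set M) := by rwa [Set.Finite.coe_toFinset]
    exact Finset.sum_nbij b hmap hinj
      (Finset.surjOn_of_injOn_of_card_le b hmap hinj (by rw [hcard, hcard])) fun _ _ => rfl
  rw [transferOp_eq_sum hx, hsum, ← Finset.sum_sub_distrib]
  set c := Real.exp (⨅ x, φ w x)
  have hc : 0 < c := Real.exp_pos _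
  set D := Metric.diam (univ : Set M) ^ (α : ℝ)
  set d := dist x y
  have hd0 : 0 ≤ d := dist_nonneg
  have hε := hφ.pos
  have hL1 := hf.one_le_L w
  have hσ := hf.one_lt_sigma w
  have hσ0 : 0 < σ w := by linarith
  have hl : 0 ≤ (L w - 1) ^ (α : ℝ) := Real.rpow_nonneg (by linarith) _
  have hs1 : σ w ^ (-(α : ℝ)) ≤ 1 := Real.rpow_le_one_of_one_le_of_nonpos hσ.le (by linarith)
  -- The factor by which the increment of `ψ` changes along the branch at `a`: the geodesic estimate
  -- in the region `A w`, true contraction outside.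
  set t : M → ℝ := fun a => if a ∈ A w then 1 + (L w - 1) ^ (α : ℝ) else σ w ^ (-(α : ℝ)) with ht
  have hdist : ∀ a ∈ hx.toFinset, dist a (b a) ≤ L w * d ∧
      |ψ a - ψ (b a)| ≤ C * (t a * d ^ (α : ℝ)) := by
    intro a ha
    rw [Set.Finite.mem_toFinset] at ha
    have h1 := hb3 a ha
    by_cases haA : a ∈ A w
    · have h2 : dist a (b a) ≤ L w * d :=
        h1.trans (mul_le_mul_of_nonneg_right (hf.lip_on_region w a haA) hd0)
      refine ⟨h2, ?_⟩
      simp only [ht, haA, if_true]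
      exact hψ.abs_sub_le_of_dist_le_mul hM hα hL1 (hf.L_le_two w) hxy hd0 h2
    · have h2 : dist a (b a) ≤ (σ w)⁻¹ * d :=
        h1.trans (mul_le_mul_of_nonneg_right (hf.lip_off_region w a haA).le hd0)
      have h3 : (σ w)⁻¹ ≤ 1 := inv_le_one_of_one_le₀ hσ.le
      refine ⟨h2.trans (by gcongr; linarith), ?_⟩
      simp only [ht, haA, if_false]
      have h4 : (σ w)⁻¹ * d ≤ d := by nlinarith
      have h5 : dist a (b a) ^ (α : ℝ) ≤ σ w ^ (-(α : ℝ)) * d ^ (α : ℝ) := by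
        rw [Real.rpow_neg hσ0.le, ← Real.inv_rpow hσ0.le, ← Real.mul_rpow (by positivity) hd0]
        gcongr
      exact (hψ a (b a) (by rw [Metric.mem_ball, dist_comm]; linarith)).trans (by gcongr)
  have ht0 : ∀ a, 0 ≤ t a := fun a => by
    simp only [ht]
    split_ifs
    · linarith
    · positivity
  have hterm : ∀ a ∈ hx.toFinset,
      |Real.exp (φ w a) * ψ a - Real.exp (φ w (b a)) * ψ (b a)| ≤
        c * d ^ (α : ℝ) * ((1 + ε * D) * C * t a + γ * S) := by
    intro a ha
    obtain ⟨h1, h2⟩ := hdist a ha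
    have e1 : Real.exp (φ w a) * ψ a - Real.exp (φ w (b a)) * ψ (b a) =
      Real.exp (φ w a) * (ψ a - ψ (b a)) +
        (Real.exp (φ w a) - Real.exp (φ w (b a))) * ψ (b a) := by ring
    have h3 : dist a (b a) ^ (α : ℝ) ≤ L w ^ (α : ℝ) * d ^ (α : ℝ) := by
      rw [← Real.mul_rpow (by linarith) hd0]
      gcongr
    have h4 : |Real.exp (φ w a) - Real.exp (φ w (b a))| ≤ c * (γ * d ^ (α : ℝ)) := by
      calc _ ≤ ε * c * dist a (b a) ^ (α : ℝ) := hφ.exp_sub_le hα w a (b a)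
        _ ≤ ε * c * (L w ^ (α : ℝ) * d ^ (α : ℝ)) := by gcongr
        _ = c * (ε * L w ^ (α : ℝ) * d ^ (α : ℝ)) := by ring
        _ ≤ _ := by gcongr
    rw [e1]
    refine (abs_add_le _ _).trans ?_
    rw [abs_mul, abs_mul, abs_of_pos (Real.exp_pos _)]
    have h5 := (hφ.exp_mem_Icc hα w a).2
    have h6 : Real.exp (φ w a) * |ψ a - ψ (b a)| ≤
        c * (1 + ε * D) * (C * (t a * d ^ (α : ℝ))) := by
      gcongr
    have h7 : |Real.exp (φ w a) - Real.exp (φ w (b a))| * |ψ (b a)| ≤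
        c * (γ * d ^ (α : ℝ)) * S :=
      mul_le_mul h4 (hS _) (abs_nonneg _) ((abs_nonneg _).trans h4)
    calc _ ≤ _ := add_le_add h6 h7
      _ = _ := by ring
  obtain ⟨𝒰, h𝒰, -, 𝒱, h𝒱, hcard𝒱, hA⟩ := hf.covering w
  have hcount : ((hx.toFinset.filter (· ∈ A w)).card : ℝ) ≤ q w := by
    exact_mod_cast (card_filter_fiber_le hx (fun U hU => (h𝒰 U (h𝒱 hU)).2) hA).trans hcard𝒱
  -- At most `q w` preimages lie in `A w`. Since the weight there is the larger one, the worst case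
  -- is exactly `q w` of them.
  have htsum : ∑ a ∈ hx.toFinset, t a ≤ ((mapDegree (f w) : ℝ) - q w) * σ w ^ (-(α : ℝ)) +
      q w * (1 + (L w - 1) ^ (α : ℝ)) := by
    have hadd := Finset.card_filter_add_card_filter_not (s := hx.toFinset) (· ∈ A w)
    rw [hcard] at hadd
    have hadd' : ((hx.toFinset.filter (· ∈ A w)).card : ℝ) +
        ((hx.toFinset.filter (¬ · ∈ A w)).card : ℝ) = mapDegree (f w) := by exact_mod_cast hadd
    simp only [ht]
    rw [Finset.sum_ite, Finset.sum_const, Finset.sum_const, nsmul_eq_mul, nsmul_eq_mul]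
    nlinarith
  calc _ ≤ ∑ a ∈ hx.toFinset, |Real.exp (φ w a) * ψ a - Real.exp (φ w (b a)) * ψ (b a)| :=
        Finset.abs_sum_le_sum_abs _ _
    _ ≤ ∑ a ∈ hx.toFinset, c * d ^ (α : ℝ) * ((1 + ε * D) * C * t a + γ * S) :=
        Finset.sum_le_sum hterm
    _ = c * d ^ (α : ℝ) * (C * ((1 + ε * D) * ∑ a ∈ hx.toFinset, t a) +
          mapDegree (f w) * (γ * S)) := by
        rw [← Finset.mul_sum, Finset.sum_add_distrib, ← Finset.mul_sum, Finset.sum_const, hcard,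
          nsmul_eq_mul]
        ring
    _ ≤ c * d ^ (α : ℝ) * (C * (mapDegree (f w) * γ) + mapDegree (f w) * (γ * S)) := by
        have h0 : 0 ≤ 1 + ε * D := by
          have : 0 ≤ D := Real.rpow_nonneg Metric.diam_nonneg _
          positivity
        have h1 := (mul_le_mul_of_nonneg_left htsum h0).trans r1
        exact mul_le_mul_of_nonneg_left (add_le_add_left
          (mul_le_mul_of_nonneg_left h1 C.coe_nonneg) _) (by positivity)
    _ = _ := by ring

end LasotaYorke

/-! ### Doeblin contraction for abstract families of operators. -/

section MixingOperators

variable {X M : Type*}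

/-- The iterates of a family of operators over the base transformation `s`. -/
noncomputable def opIter (s : X → X) (T : X → (M → ℝ) →ₗ[ℝ] (M → ℝ)) :
    ℕ → X → (M → ℝ) →ₗ[ℝ] (M → ℝ)
  | 0, _ => LinearMap.id
  | n + 1, w => T (s^[n] w) ∘ₗ opIter s T n w

theorem opIter_succ_apply (s : X → X) (T : X → (M → ℝ) →ₗ[ℝ] (M → ℝ)) (n : ℕ) (w : X)
    (u : M → ℝ) : opIter s T (n + 1) w u = T (s^[n] w) (opIter s T n w u) := rfl

theorem opIter_add_apply (s : X → X) (T : X → (M → ℝ) →ₗ[ℝ] (M → ℝ)) (a b : ℕ) (w : X)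
    (u : M → ℝ) : opIter s T (a + b) w u = opIter s T b (s^[a] w) (opIter s T a w u) := by
  induction b with
  | zero => rfl
  | succ b ih =>
    rw [← add_assoc, opIter_succ_apply, opIter_succ_apply, ih, ← Function.iterate_add_apply,
      add_comm b a]

variable [MetricSpace M] [MeasurableSpace M]

/-- A family of positive operators over the fiber maps `f` that preserves the integrals against
the probabilities `ν`, satisfies a Lasota-Yorke inequality, and is uniformly topologically exact
over the invariant set `G`: the iterate `N i` maps balls of radius `1 / (i + 1)` onto `M`. -/
structure MixingOperators (s : X → X) (f : X → M → M) (T : X → (M → ℝ) →ₗ[ℝ] (M → ℝ))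
    (ν : X → Measure M) (G : Set X) (δ : ℝ) (α γ B : ℝ≥0) (N : ℕ → ℕ) : Prop where
  mapsTo : MapsTo s G G
  prob : ∀ w ∈ G, IsProbabilityMeasure (ν w)
  surj : ∀ w ∈ G, Function.Surjective (f w)
  lower : ∀ w ∈ G, ∀ u : M → ℝ, (∀ x, 0 ≤ u x) → ∀ y, u y ≤ B * T w u (f w y)
  holder : ∀ w ∈ G, ∀ (C S : ℝ≥0) (u : M → ℝ), HolderInBalls δ C α u → (∀ x, |u x| ≤ S) →
    HolderInBalls δ (γ * (C + S)) α (T w u)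
  integral : ∀ w ∈ G, ∀ (C : ℝ≥0) (u : M → ℝ), HolderInBalls δ C α u →
    ∫ x, T w u x ∂(ν (s w)) = ∫ x, u x ∂(ν w)
  exact_pos : ∀ i, 0 < N i
  exact : ∀ i : ℕ, ∀ w ∈ G, ∀ x z, ∃ y ∈ Metric.ball x (1 / ((i : ℝ) + 1)),
    fiberIter s f (N i) w y = z

/-- The nonnegative Hölder functions of integral one with local Hölder constant `κ`. -/
structure IsConeDensity (δ : ℝ) (α κ : ℝ≥0) (ν : Measure M) (u : M → ℝ) : Prop where
  nonneg : ∀ x, 0 ≤ u x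
  holder : HolderInBalls δ κ α u
  integral : ∫ x, u x ∂ν = 1

/-- The scales 1/(i + 1) suffice, so exactness is required at countably many scales only and the
exceptional null sets can be united. -/
theorem exists_radius {δ ρ : ℝ} {α : ℝ≥0} (hδ : 0 < δ) (hα : 0 < α) (hρ : 0 < ρ) :
    ∃ i : ℕ, 1 / ((i : ℝ) + 1) < δ ∧ (1 / ((i : ℝ) + 1)) ^ (α : ℝ) ≤ ρ := by
  have hα' : (0 : ℝ) < α := hα
  obtain ⟨i, hi⟩ := exists_nat_one_div_lt (lt_min hδ (Real.rpow_pos_of_pos hρ (1 / (α : ℝ))))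
  refine ⟨i, hi.trans_le (min_le_left _ _), ?_⟩
  calc (1 / ((i : ℝ) + 1)) ^ (α : ℝ) ≤ (ρ ^ (1 / (α : ℝ))) ^ (α : ℝ) := by
        gcongr
        exact hi.le.trans (min_le_right _ _)
    _ = ρ := by rw [← Real.rpow_mul hρ.le, one_div, inv_mul_cancel₀ hα'.ne', Real.rpow_one]

namespace MixingOperators

variable {s : X → X} {f : X → M → M} {T : X → (M → ℝ) →ₗ[ℝ] (M → ℝ)} {ν : X → Measure M}
  {G : Set X} {δ : ℝ} {α γ B : ℝ≥0} {N : ℕ → ℕ} {w : X} {u : M → ℝ} {C κ S : ℝ≥0}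

theorem iterate_mem (H : MixingOperators s f T ν G δ α γ B N) (hw : w ∈ G) (n : ℕ) :
    s^[n] w ∈ G := H.mapsTo.iterate n hw

theorem apply_nonneg (H : MixingOperators s f T ν G δ α γ B N) (hB : 0 < B) (hw : w ∈ G)
    (hu : ∀ x, 0 ≤ u x) (x : M) : 0 ≤ T w u x := by
  obtain ⟨y, rfl⟩ := H.surj w hw x
  have hB' : (0 : ℝ) < B := hB
  exact nonneg_of_mul_nonneg_right ((hu y).trans (H.lower w hw u hu y)) hB'

theorem opIter_nonneg (H : MixingOperators s f T ν G δ α γ B N) (hB : 0 < B) (hw : w ∈ G)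
    (hu : ∀ x, 0 ≤ u x) (n : ℕ) (x : M) : 0 ≤ opIter s T n w u x := by
  induction n generalizing x with
  | zero => exact hu x
  | succ n ih => exact H.apply_nonneg hB (H.iterate_mem hw n) ih x

theorem le_opIter (H : MixingOperators s f T ν G δ α γ B N) (hB : 0 < B) (hw : w ∈ G)
    (hu : ∀ x, 0 ≤ u x) (n : ℕ) (y : M) :
    u y ≤ (B : ℝ) ^ n * opIter s T n w u (fiberIter s f n w y) := by
  induction n with
  | zero => simp [opIter, fiberIter]
  | succ n ih =>
    refine ih.trans ?_
    rw [pow_succ, mul_assoc]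
    gcongr
    exact H.lower _ (H.iterate_mem hw n) _ (H.opIter_nonneg hB hw hu n) _

theorem fiberIter_surjective (H : MixingOperators s f T ν G δ α γ B N) (hw : w ∈ G) (n : ℕ) :
    Function.Surjective (fiberIter s f n w) := by
  induction n with
  | zero => exact Function.surjective_id
  | succ n ih => exact (H.surj _ (H.iterate_mem hw n)).comp ih

theorem opIter_mono (H : MixingOperators s f T ν G δ α γ B N) (hB : 0 < B) (hw : w ∈ G)
    {v : M → ℝ} (huv : ∀ x, u x ≤ v x) (n : ℕ) (x : M) :
    opIter s T n w u x ≤ opIter s T n w v x := by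
  have := H.opIter_nonneg hB hw (u := v - u) (fun x => sub_nonneg.2 (huv x)) n x
  rw [map_sub, Pi.sub_apply] at this
  linarith

/-- Exactness gives a preimage of `z` under the iterate within 1/(i + 1) of `x`; there `u` is at
least `u x - C * ρ`, and the iterate at `z` dominates this value up to `B ^ N i`. -/
theorem sub_le_opIter (H : MixingOperators s f T ν G δ α γ B N) (hB : 0 < B)
    (hw : w ∈ G) (hu0 : ∀ x, 0 ≤ u x) (hu : HolderInBalls δ C α u) {i : ℕ} {ρ : ℝ}
    (hi : 1 / ((i : ℝ) + 1) < δ) (hρ : (1 / ((i : ℝ) + 1)) ^ (α : ℝ) ≤ ρ) (x z : M) :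
    u x - C * ρ ≤ (B : ℝ) ^ (N i) * opIter s T (N i) w u z := by
  obtain ⟨y, hy, rfl⟩ := H.exact i w hw x z
  refine le_trans ?_ (H.le_opIter hB hw hu0 (N i) y)
  have h1 := hu x y (Metric.ball_subset_ball hi.le hy)
  have h2 : dist x y ^ (α : ℝ) ≤ ρ := by
    refine le_trans ?_ hρ
    rw [Metric.mem_ball, dist_comm] at hy
    gcongr
  have h3 : (C : ℝ) * dist x y ^ (α : ℝ) ≤ C * ρ := by gcongr
  linarith [(abs_le.1 h1).2]

theorem isConeDensity_apply (H : MixingOperators s f T ν G δ α γ B N) (hB : 0 < B)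
    (hκS : γ * (κ + S) < κ)
    (hS : ∀ w ∈ G, ∀ u, IsConeDensity δ α κ (ν w) u → ∀ x, u x ≤ S) (hw : w ∈ G)
    (hu : IsConeDensity δ α κ (ν w) u) :
    IsConeDensity δ α κ (ν (s w)) (T w u) ∧ HolderInBalls δ (γ * (κ + S)) α (T w u) := by
  have h1 := H.holder w hw κ S u hu.holder fun x => by
    rw [abs_of_nonneg (hu.nonneg x)]
    exact hS w hw u hu x
  exact ⟨⟨H.apply_nonneg hB hw hu.nonneg, h1.mono hκS.le,
    (H.integral w hw _ u hu.holder).trans hu.integral⟩, h1⟩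

theorem isConeDensity_opIter (H : MixingOperators s f T ν G δ α γ B N) (hB : 0 < B)
    (hκS : γ * (κ + S) < κ)
    (hS : ∀ w ∈ G, ∀ u, IsConeDensity δ α κ (ν w) u → ∀ x, u x ≤ S) (hw : w ∈ G)
    (hu : IsConeDensity δ α κ (ν w) u) (n : ℕ) :
    IsConeDensity δ α κ (ν (s^[n] w)) (opIter s T n w u) := by
  induction n with
  | zero => exact hu
  | succ n ih =>
    rw [Function.iterate_succ_apply']
    exact (H.isConeDensity_apply hB hκS hS (H.iterate_mem hw n) ih).1

-- The Hölder constants of iterates found next need not be uniform in `n`; they serve for continuity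
-- and integrability.
variable [CompactSpace M]

theorem exists_holder_opIter (H : MixingOperators s f T ν G δ α γ B N) (hδ : 0 < δ) (hα : 0 < α)
    (hw : w ∈ G) (hu : HolderInBalls δ C α u) (n : ℕ) :
    ∃ C', HolderInBalls δ C' α (opIter s T n w u) := by
  induction n with
  | zero => exact ⟨C, hu⟩
  | succ n ih =>
    obtain ⟨C', hC'⟩ := ih
    obtain ⟨R, hR⟩ := exists_abs_le_of_continuous (hC'.continuous hδ hα)
    exact ⟨_, H.holder _ (H.iterate_mem hw n) _ _ _ hC' hR⟩

theorem integral_opIter (H : MixingOperators s f T ν G δ α γ B N) (hδ : 0 < δ) (hα : 0 < α)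
    (hw : w ∈ G) (hu : HolderInBalls δ C α u) (n : ℕ) :
    ∫ x, opIter s T n w u x ∂(ν (s^[n] w)) = ∫ x, u x ∂(ν w) := by
  induction n with
  | zero => rfl
  | succ n ih =>
    obtain ⟨C', hC'⟩ := H.exists_holder_opIter hδ hα hw hu n
    rw [Function.iterate_succ_apply', opIter_succ_apply,
      H.integral _ (H.iterate_mem hw n) _ _ hC', ih]

variable [BorelSpace M]

theorem _root_.integrable_of_holderInBalls {μ : Measure M} [IsFiniteMeasure μ] (hδ : 0 < δ)
    (hα : 0 < α) (hu : HolderInBalls δ C α u) : Integrable u μ :=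
  (hu.continuous hδ hα).integrable_of_hasCompactSupport (HasCompactSupport.of_compactSpace u)

/-- Integrating `sub_le_opIter` over `z` gives u(x) ≤ κρ + B^N, as integrals are preserved. Here N
depends on ρ but not on κ, so κ may be chosen afterwards. -/
theorem exists_cone_bound (H : MixingOperators s f T ν G δ α γ B N) (hδ : 0 < δ) (hα : 0 < α)
    (hB : 0 < B) (hγ : γ < 1) :
    ∃ κ S : ℝ≥0, γ * (κ + S) < κ ∧
      ∀ w ∈ G, ∀ u, IsConeDensity δ α κ (ν w) u → ∀ x, u x ≤ S := by
  have hγ' : (γ : ℝ) < 1 := hγ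
  have hB' : (0 : ℝ) < B := hB
  set ρ : ℝ≥0 := (1 - γ) / 2
  have hρ : (ρ : ℝ) = (1 - γ) / 2 := by
    simp only [ρ]
    push_cast [NNReal.coe_sub hγ.le]
    rfl
  have hρ0 : (0 : ℝ) < ρ := by rw [hρ]; linarith
  obtain ⟨i, hi, hiρ⟩ := exists_radius hδ hα hρ0
  -- With γ = 1 - 2ρ, invariance of the cone requires γ(κρ + B^N) < 2κρ; for κρ = 2B^N the left side
  -- is at most 3B^N and the right side is 4B^N.
  set κ : ℝ≥0 := 2 * B ^ N i / ρ
  have hκ : (κ : ℝ) * ρ = 2 * B ^ N i := by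
    simp only [κ]
    push_cast
    field_simp
  refine ⟨κ, κ * ρ + B ^ N i, ?_, fun w hw u hu x => ?_⟩
  · rw [← NNReal.coe_lt_coe]
    push_cast
    have hBn : (0 : ℝ) < (B : ℝ) ^ N i := by positivity
    have hγ0 := γ.coe_nonneg
    have h1 : (γ : ℝ) = 1 - 2 * ρ := by rw [hρ]; ring
    have h2 : (γ : ℝ) * (κ * ρ + B ^ N i) ≤ κ * ρ + B ^ N i := by nlinarith
    have h3 : (γ : ℝ) * κ = κ - 2 * (κ * ρ) := by rw [h1]; ring
    rw [mul_add, h3]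
    linarith
  · have := H.prob _ (H.iterate_mem hw (N i))
    obtain ⟨C', hC'⟩ := H.exists_holder_opIter hδ hα hw hu.holder (N i)
    have h1 : ∫ _, (u x - κ * ρ) ∂(ν (s^[N i] w)) ≤
        ∫ z, (B : ℝ) ^ (N i) * opIter s T (N i) w u z ∂(ν (s^[N i] w)) :=
      integral_mono (integrable_const _) ((integrable_of_holderInBalls hδ hα hC').const_mul _)
        fun z => H.sub_le_opIter hB hw hu.nonneg hu.holder hi hiρ x z
    rw [integral_const_mul, H.integral_opIter hδ hα hw hu.holder, hu.integral] at h1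
    simp only [integral_const, probReal_univ, smul_eq_mul, one_mul, mul_one] at h1
    push_cast
    linarith

/-- A density of integral one is at least 1 somewhere; at a scale where it oscillates by at most
1/2, exactness spreads the value 1/2 over M. -/
theorem exists_cone_lower (H : MixingOperators s f T ν G δ α γ B N) (hδ : 0 < δ) (hα : 0 < α)
    (hB : 0 < B) (hκ : 0 < κ) : ∃ n : ℕ, 0 < n ∧ ∃ c : ℝ, 0 < c ∧
      ∀ w ∈ G, ∀ u, IsConeDensity δ α κ (ν w) u → ∀ z, c ≤ opIter s T n w u z := by
  have hκ' : (0 : ℝ) < κ := hκ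
  have hB' : (0 : ℝ) < B := hB
  obtain ⟨i, hi, hiρ⟩ := exists_radius hδ hα (show (0 : ℝ) < 1 / (2 * κ) by positivity)
  refine ⟨N i, H.exact_pos i, 1 / (2 * (B : ℝ) ^ N i), by positivity, fun w hw u hu z => ?_⟩
  have := H.prob w hw
  obtain ⟨x, hx⟩ := exists_integral_le (integrable_of_holderInBalls hδ hα hu.holder (μ := ν w))
  rw [hu.integral] at hx
  have h1 := H.sub_le_opIter hB hw hu.nonneg hu.holder hi hiρ x z
  have h2 : (κ : ℝ) * (1 / (2 * κ)) = 1 / 2 := by field_simp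
  rw [div_le_iff₀ (by positivity)]
  linarith

/-- Uniform exponential contraction on the cone, by splitting off a constant multiple of `1`. -/
theorem exists_contraction (H : MixingOperators s f T ν G δ α γ B N) (hδ : 0 < δ) (hα : 0 < α)
    (hB : 0 < B) (hκS : γ * (κ + S) < κ)
    (hS : ∀ w ∈ G, ∀ u, IsConeDensity δ α κ (ν w) u → ∀ x, u x ≤ S) :
    ∃ τ K : ℝ, 0 < τ ∧ τ < 1 ∧ 0 ≤ K ∧ ∀ n, ∀ w ∈ G, ∀ u v, IsConeDensity δ α κ (ν w) u →
      IsConeDensity δ α κ (ν w) v → ∀ x,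
        |opIter s T n w u x - opIter s T n w v x| ≤ K * τ ^ n := by
  have hκ : 0 < κ := pos_of_gt hκS
  have hκ' : (0 : ℝ) < κ := hκ
  have hκS' : (γ : ℝ) * (κ + S) < κ := by exact_mod_cast hκS
  obtain ⟨n₀, hn₀, c, hc, hlow⟩ := H.exists_cone_lower hδ hα hB hκ
  obtain ⟨k, rfl⟩ := Nat.exists_eq_succ_of_ne_zero hn₀.ne'
  -- The three bounds keep the remainder nonnegative, keep `1 - η` away from 0, and keep the Hölder
  -- constant at most `κ` after division by `1 - η`.
  set η : ℝ := min c (min (1 / 2) (1 - γ * (κ + S) / κ)) with hη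
  have hη0 : 0 < η := by
    have : γ * (κ + S) / κ < (1 : ℝ) := (div_lt_one hκ').2 hκS'
    exact lt_min hc (lt_min (by norm_num) (by linarith))
  have hηc : η ≤ c := min_le_left _ _
  have hη1 : η ≤ 1 / 2 := (min_le_right _ _).trans (min_le_left _ _)
  have hηκ : γ * (κ + S) ≤ (1 - η) * κ := by
    have h1 : η ≤ 1 - γ * (κ + S) / κ := (min_le_right _ _).trans (min_le_right _ _)
    have h2 : γ * (κ + S) / κ * κ = (γ * (κ + S) : ℝ) := by field_simp
    nlinarith
  set r : ℝ≥0 := (1 - η).toNNReal⁻¹ with hr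
  have hr' : (r : ℝ) = (1 - η)⁻¹ := by
    rw [hr, NNReal.coe_inv, Real.coe_toNNReal _ (by linarith)]
  have hη' : 0 < 1 - η := by linarith
  have hsplit : ∀ w ∈ G, ∀ u, IsConeDensity δ α κ (ν w) u →
      IsConeDensity δ α κ (ν (s^[k + 1] w)) (fun x => r * (opIter s T (k + 1) w u x + -η)) := by
    intro w hw u hu
    have h1 := H.isConeDensity_opIter hB hκS hS hw hu k
    obtain ⟨h2, h3⟩ := H.isConeDensity_apply hB hκS hS (H.iterate_mem hw k) h1
    rw [← Function.iterate_succ_apply' s k w] at h2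
    rw [← opIter_succ_apply] at h2 h3
    refine ⟨fun x => ?_, (h3.affine (-η) r).mono ?_, ?_⟩
    · have := hlow w hw u hu x
      exact mul_nonneg r.coe_nonneg (by linarith)
    · rw [← NNReal.coe_le_coe, NNReal.coe_mul, hr', inv_mul_le_iff₀ hη']
      exact_mod_cast hηκ
    · have := H.prob _ (H.iterate_mem hw (k + 1))
      rw [integral_const_mul, integral_add (integrable_of_holderInBalls hδ hα h2.holder)
        (integrable_const _), h2.integral, hr']
      simp only [integral_const, probReal_univ, smul_eq_mul, one_mul]
      rw [← sub_eq_add_neg, inv_mul_cancel₀ hη'.ne']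
  -- By Bernoulli's inequality `τ ^ (k + 1) ≥ 1 - η`, so one block of `k + 1` steps contracts at
  -- least as fast as `τ` per step.
  set τ : ℝ := 1 - η / (k + 1) with hτ
  have hk : (0 : ℝ) < (k : ℝ) + 1 := by positivity
  have hτ1 : τ < 1 := by have : 0 < η / (k + 1) := by positivity
                         linarith
  have hτ0 : 1 / 2 ≤ τ := by
    have : η / (k + 1) ≤ η := div_le_self hη0.le (by linarith [(Nat.cast_nonneg k : (0 : ℝ) ≤ k)])
    linarith
  have hτpos : 0 < τ := by linarith
  have hτk : 1 - η ≤ τ ^ (k + 1) := by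
    have h1 := one_add_mul_le_pow (a := -(η / (k + 1))) (by linarith) (k + 1)
    have h2 : 1 + ((k + 1 : ℕ) : ℝ) * -(η / (k + 1)) = 1 - η := by
      push_cast
      field_simp
      ring
    rw [h2] at h1
    exact h1
  -- This constant makes the trivial bound `S` sufficient for all `n < k + 1`.
  refine ⟨τ, S / τ ^ (k + 1), hτpos, hτ1, by positivity, fun n => ?_⟩
  induction n using Nat.strong_induction_on with
  | _ n ih =>
  intro w hw u v hu hv x
  rcases lt_or_ge n (k + 1) with hn | hn
  · have h1 := H.isConeDensity_opIter hB hκS hS hw hu n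
    have h2 := H.isConeDensity_opIter hB hκS hS hw hv n
    have h3 := hS _ (H.iterate_mem hw n) _ h1 x
    have h4 := hS _ (H.iterate_mem hw n) _ h2 x
    have h5 := h1.nonneg x
    have h6 := h2.nonneg x
    have h7 : (S : ℝ) ≤ S / τ ^ (k + 1) * τ ^ n := by
      rw [div_mul_eq_mul_div, le_div_iff₀ (by positivity)]
      exact mul_le_mul_of_nonneg_left (pow_le_pow_of_le_one hτpos.le hτ1.le hn.le) S.coe_nonneg
    exact (abs_sub_le_of_nonneg_of_le h5 h3 h6 h4).trans h7
  · obtain ⟨j, rfl⟩ := Nat.exists_eq_add_of_le hn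
    -- The constant part is the same for `u` and `v`, so it cancels whatever the operators do to
    -- constants.
    have hback : ∀ u : M → ℝ, opIter s T (k + 1) w u =
        η • (fun _ => (1 : ℝ)) + (1 - η) • fun x => r * (opIter s T (k + 1) w u x + -η) := by
      intro u
      funext y
      simp only [Pi.add_apply, Pi.smul_apply, smul_eq_mul, hr']
      field_simp
      ring
    have h1 := ih j (by omega) _ (H.iterate_mem hw (k + 1)) _ _ (hsplit w hw u hu)
      (hsplit w hw v hv) x
    rw [opIter_add_apply s T (k + 1) j, opIter_add_apply s T (k + 1) j, hback u, hback v, map_add, map_add, map_smul, map_smul,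
      map_smul]
    simp only [Pi.add_apply, Pi.smul_apply, smul_eq_mul]
    rw [add_sub_add_left_eq_sub, ← mul_sub, abs_mul, abs_of_pos hη', pow_add]
    calc _ ≤ τ ^ (k + 1) * (S / τ ^ (k + 1) * τ ^ j) := by
          gcongr
      _ = _ := by ring

/-- Adding a large constant to `u` and normalizing gives a function in the cone, which is then
compared with the constant 1. -/
theorem exists_abs_opIter_sub_le (hδ : 0 < δ) (hα : 0 < α) (hκ : 0 < κ) {τ K : ℝ}
    (hK : ∀ n, ∀ w ∈ G, ∀ u v, IsConeDensity δ α κ (ν w) u →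
      IsConeDensity δ α κ (ν w) v → ∀ x,
        |opIter s T n w u x - opIter s T n w v x| ≤ K * τ ^ n)
    (hw : w ∈ G) [IsProbabilityMeasure (ν w)] (hu0 : ∀ x, 0 ≤ u x) (hu : HolderInBalls δ C α u) :
    ∃ K' : ℝ, ∀ n x, |opIter s T n w u x -
      (∫ x, u x ∂(ν w)) * opIter s T n w (fun _ => 1) x| ≤ K' * τ ^ n := by
  have hκ' : (0 : ℝ) < κ := hκ
  set I := ∫ x, u x ∂(ν w)
  have hI : 0 ≤ I := integral_nonneg hu0
  -- `C / κ` brings the normalized Hölder constant down to `κ`; the summand 1 keeps the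
  -- normalization positive when `u` vanishes.
  set R : ℝ := C / κ + 1 with hR
  have hR0 : 0 < R := by positivity
  set r : ℝ≥0 := (I + R).toNNReal⁻¹ with hr
  have hr' : (r : ℝ) = (I + R)⁻¹ := by
    rw [hr, NNReal.coe_inv, Real.coe_toNNReal _ (by linarith)]
  have hIR : 0 < I + R := by linarith
  have h1 : IsConeDensity δ α κ (ν w) (fun _ => 1) :=
    ⟨fun _ => zero_le_one, fun x y _ => by rw [sub_self, abs_zero]; positivity, by simp⟩
  have h2 : IsConeDensity δ α κ (ν w) (fun x => r * (u x + R)) := by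
    refine ⟨fun x => mul_nonneg r.coe_nonneg (by linarith [hu0 x]), (hu.affine R r).mono ?_, ?_⟩
    · rw [← NNReal.coe_le_coe, NNReal.coe_mul, hr', inv_mul_le_iff₀ hIR]
      have : (C : ℝ) / κ * κ = C := by field_simp
      nlinarith
    · rw [integral_const_mul, integral_add (integrable_of_holderInBalls hδ hα hu)
        (integrable_const _), hr']
      simp only [integral_const, probReal_univ, smul_eq_mul, one_mul]
      exact inv_mul_cancel₀ hIR.ne'
  have h3 : (fun x => r * (u x + R)) = (r : ℝ) • u + ((r : ℝ) * R) • fun _ => (1 : ℝ) := by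
    funext x
    simp only [Pi.add_apply, Pi.smul_apply, smul_eq_mul]
    ring
  refine ⟨(I + R) * K, fun n x => ?_⟩
  have h4 := hK n w hw _ _ h2 h1 x
  rw [h3, map_add, map_smul, map_smul] at h4
  simp only [Pi.add_apply, Pi.smul_apply, smul_eq_mul, hr'] at h4
  have h5 : opIter s T n w u x - I * opIter s T n w (fun _ => 1) x =
      (I + R) * ((I + R)⁻¹ * opIter s T n w u x + (I + R)⁻¹ * R * opIter s T n w (fun _ => 1) x -
        opIter s T n w (fun _ => 1) x) := by
    field_simp
    ring
  rw [h5, abs_mul, abs_of_pos hIR, mul_assoc (I + R)]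
  exact mul_le_mul_of_nonneg_left h4 hIR.le

/-- Exponential convergence of the iterates to the multiples of the iterates of a positive
density, with a rate that is the same for all points of `G`. -/
theorem exists_rate (H : MixingOperators s f T ν G δ α γ B N) (hδ : 0 < δ) (hα : 0 < α)
    (hB : 1 ≤ B) (hγ : γ < 1) :
    ∃ τ : ℝ, 0 < τ ∧ τ < 1 ∧ ∀ w ∈ G, ∀ h : M → ℝ, (∃ C, HolderInBalls δ C α h) →
      (∃ c : ℝ, 0 < c ∧ ∀ x, c ≤ h x) → ∫ x, h x ∂(ν w) = 1 →
      ∀ u : M → ℝ, (∀ x, 0 ≤ u x) → (∃ C, HolderInBalls δ C α u) →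
        ∃ K : ℝ, 0 < K ∧ ∀ n x, |opIter s T n w u x - (∫ x, u x ∂(ν w)) * opIter s T n w h x| ≤
          K * τ ^ n * opIter s T n w h x := by
  have hB0 : 0 < B := zero_lt_one.trans_le hB
  have hB1 : (1 : ℝ) ≤ B := hB
  obtain ⟨κ, S, hκS, hS⟩ := H.exists_cone_bound hδ hα hB0 hγ
  have hκ : 0 < κ := pos_of_gt hκS
  obtain ⟨τ, K, hτ0, hτ1, -, hK⟩ := H.exists_contraction hδ hα hB0 hκS hS
  obtain ⟨n₀, -, c, hc, hlow⟩ := H.exists_cone_lower hδ hα hB0 hκ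
  refine ⟨τ, hτ0, hτ1, ?_⟩
  rintro w hw h ⟨Ch, hh⟩ ⟨b, hb, hbh⟩ hint u hu0 ⟨Cu, hu⟩
  have hprob := H.prob w hw
  have hone : IsConeDensity δ α κ (ν w) (fun _ => 1) :=
    ⟨fun _ => zero_le_one, fun x y _ => by rw [sub_self, abs_zero]; positivity, by simp⟩
  obtain ⟨Ku, hKu⟩ := exists_abs_opIter_sub_le hδ hα hκ hK hw hu0 hu
  obtain ⟨Kh, hKh⟩ := exists_abs_opIter_sub_le hδ hα hκ hK hw (fun x => hb.le.trans (hbh x)) hh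
  rw [hint] at hKh
  -- For `n ≥ n₀` the last `n₀` steps give the bound `c`; for smaller `n` a single preimage
  -- contributes at least `(B ^ n)⁻¹`.
  have hlow1 : ∀ n x, min c ((B : ℝ) ^ n₀)⁻¹ ≤ opIter s T n w (fun _ => 1) x := by
    intro n x
    rcases lt_or_ge n n₀ with hn | hn
    · obtain ⟨y, rfl⟩ := H.fiberIter_surjective hw n x
      have h1 := H.le_opIter hB0 hw hone.nonneg n y
      refine (min_le_right _ _).trans ?_
      have h2 : (B : ℝ) ^ n ≤ (B : ℝ) ^ n₀ := pow_le_pow_right₀ hB1 hn.le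
      have h3 := H.opIter_nonneg hB0 hw hone.nonneg n (fiberIter s f n w y)
      rw [inv_le_iff_one_le_mul₀ (by positivity)]
      nlinarith
    · obtain ⟨j, rfl⟩ := Nat.exists_eq_add_of_le' hn
      rw [opIter_add_apply]
      exact (min_le_left _ _).trans (hlow _ (H.iterate_mem hw j) _
        (H.isConeDensity_opIter hB0 hκS hS hw hone j) x)
  set c' := min c ((B : ℝ) ^ n₀)⁻¹
  have hc' : 0 < c' := lt_min hc (by positivity)
  have hlowh : ∀ n x, b * c' ≤ opIter s T n w h x := by
    intro n x
    have h1 := H.opIter_mono hB0 hw (u := b • fun _ => (1 : ℝ)) (v := h) (by simpa using hbh) n x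
    rw [map_smul, Pi.smul_apply, smul_eq_mul] at h1
    exact (mul_le_mul_of_nonneg_left (hlow1 n x) hb.le).trans h1
  set I := ∫ x, u x ∂(ν w)
  have hI : 0 ≤ I := integral_nonneg hu0
  set K₁ := |Ku| + I * |Kh| + 1
  have hK₁ : 0 < K₁ := by positivity
  refine ⟨K₁ / (b * c'), by positivity, fun n x => ?_⟩
  have h1 := abs_le.1 (hKu n x)
  have h2 := abs_le.1 (hKh n x)
  have hτn : 0 < τ ^ n := pow_pos hτ0 n
  have h3 : |opIter s T n w u x - I * opIter s T n w h x| ≤ K₁ * τ ^ n := by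
    have e : opIter s T n w u x - I * opIter s T n w h x =
      (opIter s T n w u x - I * opIter s T n w (fun _ => 1) x) -
        I * (opIter s T n w h x - 1 * opIter s T n w (fun _ => 1) x) := by ring
    rw [e]
    refine (abs_sub _ _).trans ?_
    rw [abs_mul, abs_of_nonneg hI]
    have a1 : Ku * τ ^ n ≤ |Ku| * τ ^ n := by gcongr; exact le_abs_self _
    have a2 : I * (Kh * τ ^ n) ≤ I * (|Kh| * τ ^ n) := by gcongr; exact le_abs_self _
    have a3 := mul_le_mul_of_nonneg_left (hKh n x) hI
    have a4 : K₁ * τ ^ n = |Ku| * τ ^ n + I * (|Kh| * τ ^ n) + τ ^ n := by ring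
    linarith [hKu n x]
  refine h3.trans ?_
  have h4 : K₁ / (b * c') * τ ^ n * (b * c') = K₁ * τ ^ n := by field_simp
  rw [← h4]
  gcongr
  exact hlowh n x

end MixingOperators

end MixingOperators

/-! ### Uniform topological exactness from ergodicity. -/

section UniformExactness

variable {X M : Type*} [MeasurableSpace X] [MetricSpace M] [CompactSpace M] [ConnectedSpace M]
  [MeasurableSpace M] [BorelSpace M] {P : Measure X} {θ : X → X} {f : X → M → M}
  {ℓ : X → M → ℝ} {A : X → Set M} {σ L : X → ℝ} {q : X → ℕ} {δ : ℝ}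

theorem continuous_fiberIter {X M : Type*} [TopologicalSpace M] {θ : X → X} {f : X → M → M}
    (hf : ∀ w, Continuous (f w)) (n : ℕ) (w : X) : Continuous (fiberIter θ f n w) := by
  induction n with
  | zero => exact continuous_id
  | succ n ih => exact (hf _).comp ih

theorem surjective_fiberIter {X M : Type*} {θ : X → X} {f : X → M → M}
    (hf : ∀ w, Function.Surjective (f w)) (n : ℕ) (w : X) :
    Function.Surjective (fiberIter θ f n w) := by
  induction n with
  | zero => exact Function.surjective_id
  | succ n ih => exact (hf _).comp ih

theorem measurable_fiberIter {X M : Type*} [MeasurableSpace X] [MeasurableSpace M] {θ : X → X}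
    {f : X → M → M} (hθ : Measurable θ) (hf : Measurable (fun z : X × M => f z.1 z.2)) (n : ℕ)
    (x : M) : Measurable fun w => fiberIter θ f n w x := by
  induction n with
  | zero => exact measurable_const
  | succ n ih => exact hf.comp ((hθ.iterate n).prodMk ih)

/-- By ergodicity, the time of topological exactness at a given scale can be chosen the same at
almost every point of the base. -/
theorem GeneratingMaps.exists_uniform_exact (hf : GeneratingMaps θ f ℓ A σ L q δ)
    (hM : IsGeodesicSpace M) (hδ : 0 < δ) [IsProbabilityMeasure P] (hθ : Ergodic θ P) {r : ℝ}
    (hr : 0 < r) : ∃ n : ℕ, 0 < n ∧ ∀ᵐ w ∂P, ∀ x z, ∃ y ∈ Metric.ball x r,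
      fiberIter θ f n w y = z := by
  have hcont : ∀ n w, Continuous (fiberIter θ f n w) :=
    continuous_fiberIter fun w => (hf.isLocalHomeomorph w).continuous
  have hsurj : ∀ n w, Function.Surjective (fiberIter θ f n w) :=
    surjective_fiberIter fun w => hf.surjective hM hδ w
  set D := TopologicalSpace.denseSeq M
  have hD : DenseRange D := TopologicalSpace.denseRange_denseSeq M
  have hr3 : 0 < r / 3 := by positivity
  -- A measurable form of exactness: centers, targets and test points run over a dense sequence.
  -- Compactness of closed balls upgrades approximate hits to exact ones, and the radius r/3 leaves
  -- room for moving the center.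
  set Q : ℕ → Set X := fun n => ⋂ (a : ℕ) (b : ℕ) (k : ℕ), ⋃ (c : ℕ)
    (_ : D c ∈ Metric.ball (D a) (r / 3)),
    (fun w => dist (fiberIter θ f n w (D c)) (D b)) ⁻¹' Iio (1 / ((k : ℝ) + 1)) with hQ
  have hQmeas : ∀ n, MeasurableSet (Q n) := fun n =>
    MeasurableSet.iInter fun a => MeasurableSet.iInter fun b => MeasurableSet.iInter fun k =>
      MeasurableSet.iUnion fun c => MeasurableSet.iUnion fun _ =>
        ((measurable_fiberIter hθ.measurable hf.measurable n (D c)).dist measurable_const)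
          measurableSet_Iio
  have hQexact : ∀ n, ∀ w ∈ Q n, ∀ x z, ∃ y ∈ Metric.ball x r, fiberIter θ f n w y = z := by
    intro n w hw x z
    obtain ⟨a, ha⟩ := hD.exists_mem_open Metric.isOpen_ball ⟨x, Metric.mem_ball_self hr3⟩
    have hcl : IsClosed (fiberIter θ f n w '' Metric.closedBall (D a) (r / 3)) :=
      (Metric.isClosed_closedBall.isCompact.image (hcont n w)).isClosed
    have hsub : range D ⊆ fiberIter θ f n w '' Metric.closedBall (D a) (r / 3) := by
      rintro _ ⟨b, rfl⟩
      rw [← hcl.closure_eq, Metric.mem_closure_iff]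
      intro e he
      obtain ⟨k, hk⟩ := exists_nat_one_div_lt he
      simp only [hQ, mem_iInter, mem_iUnion, mem_preimage, mem_Iio] at hw
      obtain ⟨c, hc, hcd⟩ := hw a b k
      refine ⟨_, mem_image_of_mem _ (Metric.ball_subset_closedBall hc), ?_⟩
      rw [dist_comm]
      exact hcd.trans hk
    have hz : z ∈ fiberIter θ f n w '' Metric.closedBall (D a) (r / 3) :=
      closure_minimal hsub hcl (hD z)
    obtain ⟨y, hy, rfl⟩ := hz
    refine ⟨y, ?_, rfl⟩
    rw [Metric.mem_closedBall] at hy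
    rw [Metric.mem_ball] at ha ⊢
    linarith [dist_triangle y (D a) x]
  set G : ℕ → Set X := fun n => ⋂ j : ℕ, θ^[j] ⁻¹' Q n
  have hGmeas : ∀ n, MeasurableSet (G n) := fun n =>
    MeasurableSet.iInter fun j => (hθ.measurable.iterate j) (hQmeas n)
  have hcover : ∀ w, ∃ n, w ∈ G (n + 1) := by
    intro w
    obtain ⟨n, hn, hex⟩ := hf.exact w (r / 3) hr3
    obtain ⟨n, rfl⟩ := Nat.exists_eq_succ_of_ne_zero hn.ne'
    refine ⟨n, mem_iInter.2 fun j => ?_⟩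
    simp only [hQ, mem_iInter, mem_iUnion, mem_preimage, mem_Iio]
    intro a b k
    obtain ⟨x, hx⟩ := hsurj j w (D a)
    have h1 := hex j x
    rw [hx] at h1
    obtain ⟨y, hy, hyb⟩ : D b ∈ fiberIter θ f (n + 1) (θ^[j] w) '' Metric.ball (D a) (r / 3) := by
      rw [h1]
      trivial
    obtain ⟨c, hc⟩ := hD.exists_mem_open (Metric.isOpen_ball.inter
      (Metric.isOpen_ball.preimage (hcont (n + 1) (θ^[j] w))))
      ⟨y, hy, by
        rw [mem_preimage, hyb]
        exact Metric.mem_ball_self (Nat.one_div_pos_of_nat (n := k))⟩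
    exact ⟨c, hc.1, hc.2⟩
  -- Countably many sets `G (n + 1)` cover X, so one has positive measure; being forward invariant,
  -- it has full measure by ergodicity.
  obtain ⟨n, hn⟩ : ∃ n, P (G (n + 1)) ≠ 0 := by
    by_contra! hall
    have h1 := measure_iUnion_null hall
    rw [(iUnion_eq_univ_iff.2 hcover), measure_univ] at h1
    exact one_ne_zero h1
  refine ⟨n + 1, n.succ_pos, ?_⟩
  have hinv : G (n + 1) ⊆ θ ⁻¹' G (n + 1) := by
    intro w hw
    exact mem_iInter.2 fun j => mem_iInter.1 hw (j + 1)
  rcases hθ.ae_empty_or_univ_of_ae_le_preimage (hGmeas (n + 1)).nullMeasurableSet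
    (Filter.Eventually.of_forall hinv) with h0 | h1
  · exact absurd (ae_eq_empty.1 h0) hn
  · filter_upwards [Filter.eventuallyEq_univ.1 h1] with w hw
    exact hQexact (n + 1) w (mem_iInter.1 hw 0)

end UniformExactness

/-- Take the points whose whole forward orbit satisfies `p`. -/
theorem MeasureTheory.MeasurePreserving.exists_mapsTo_of_ae {X : Type*} [MeasurableSpace X]
    {P : Measure X} {θ : X → X} (hθ : MeasurePreserving θ P P) {p : X → Prop}
    (hp : ∀ᵐ w ∂P, p w) : ∃ G : Set X, (∀ᵐ w ∂P, w ∈ G) ∧ MapsTo θ G G ∧ ∀ w ∈ G, p w := by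
  have h : ∀ᵐ w ∂P, ∀ j : ℕ, p (θ^[j] w) := ae_all_iff.2 fun j =>
    (hθ.iterate j).quasiMeasurePreserving.ae hp
  exact ⟨_, h, fun w hw j => hw (j + 1), fun w hw => hw 0⟩

/-! ### Measures with a continuous density. -/

section WeightedMeasures

variable {M : Type*} [TopologicalSpace M] [MeasurableSpace M] [BorelSpace M]
  {μ : Measure M} {u g : M → ℝ}

theorem integral_withDensity_ofReal (hu : Continuous u) (hu0 : ∀ x, 0 ≤ u x) (g : M → ℝ) :
    ∫ x, g x ∂(μ.withDensity fun x => ENNReal.ofReal (u x)) = ∫ x, u x * g x ∂μ := by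
  rw [integral_withDensity_eq_integral_toReal_smul hu.measurable.ennreal_ofReal
    (Filter.Eventually.of_forall fun _ => ENNReal.ofReal_lt_top)]
  simp only [ENNReal.toReal_ofReal (hu0 _), smul_eq_mul]

theorem integrable_withDensity_ofReal (hu : Continuous u) (hu0 : ∀ x, 0 ≤ u x) :
    Integrable g (μ.withDensity fun x => ENNReal.ofReal (u x)) ↔
      Integrable (fun x => u x * g x) μ := by
  rw [integrable_withDensity_iff_integrable_smul' hu.measurable.ennreal_ofReal
    (Filter.Eventually.of_forall fun _ => ENNReal.ofReal_lt_top)]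
  simp only [ENNReal.toReal_ofReal (hu0 _), smul_eq_mul]

variable [CompactSpace M]

theorem MeasureTheory.Integrable.continuous_mul (hg : Integrable g μ) (hu : Continuous u) :
    Integrable (fun x => u x * g x) μ := by
  obtain ⟨R, hR⟩ := isCompact_univ.exists_bound_of_continuousOn hu.continuousOn
  exact hg.bdd_mul hu.measurable.aestronglyMeasurable
    (Filter.Eventually.of_forall fun x => hR x (mem_univ x))

theorem integrable_of_withDensity_ofReal (hu : Continuous u) (hu0 : ∀ x, 0 < u x)
    (hg : Integrable g (μ.withDensity fun x => ENNReal.ofReal (u x))) : Integrable g μ := by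
  have h1 := ((integrable_withDensity_ofReal hu fun x => (hu0 x).le).1 hg).continuous_mul
    (hu.inv₀ fun x => (hu0 x).ne')
  refine h1.congr (Filter.Eventually.of_forall fun x => ?_)
  simp only [Pi.inv_apply]
  rw [inv_mul_cancel_left₀ (hu0 x).ne']

theorem isFiniteMeasure_withDensity_of_continuous [IsFiniteMeasure μ] (hu : Continuous u) :
    IsFiniteMeasure (μ.withDensity fun x => ENNReal.ofReal (u x)) :=
  isFiniteMeasure_withDensity_ofReal
    (hu.integrable_of_hasCompactSupport (HasCompactSupport.of_compactSpace u)).2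

end WeightedMeasures

/-! ### The normalized transfer operators of the family. -/

section NormalizedTransfer

variable {X M : Type*}

/-- The transfer operator of a map with finite fibers as a linear map. -/
noncomputable def transferLinearMap (g : M → M) (hg : ∀ x, (g ⁻¹' {x}).Finite) (u : M → ℝ) :
    (M → ℝ) →ₗ[ℝ] (M → ℝ) where
  toFun := transferOp g u
  map_add' ψ ψ' := by
    funext x
    simp only [Pi.add_apply, transferOp_eq_sum (hg x), mul_add, Finset.sum_add_distrib]
  map_smul' c ψ := by
    funext x
    simp only [Pi.smul_apply, transferOp_eq_sum (hg x), smul_eq_mul, Finset.mul_sum,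
      RingHom.id_apply]
    exact Finset.sum_congr rfl fun y _ => by ring

/-- The transfer operators divided by the numbers `λ_w`. -/
noncomputable def normalizedTransfer [MeasurableSpace X] [MeasurableSpace M] (θ : X → X)
    (f : X → M → M) (hfin : ∀ w x, (f w ⁻¹' {x}).Finite) (φ : X → M → ℝ) (ν : Kernel X M) (w : X) :
    (M → ℝ) →ₗ[ℝ] (M → ℝ) :=
  (eigenvalue θ f φ ν w)⁻¹ • transferLinearMap (f w) (hfin w) (φ w)

theorem normalizedTransfer_apply [MeasurableSpace X] [MeasurableSpace M] (θ : X → X)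
    (f : X → M → M) (hfin : ∀ w x, (f w ⁻¹' {x}).Finite) (φ : X → M → ℝ) (ν : Kernel X M) (w : X)
    (ψ : M → ℝ) (x : M) : normalizedTransfer θ f hfin φ ν w ψ x =
      (eigenvalue θ f φ ν w)⁻¹ * transferOp (f w) (φ w) ψ x := rfl

variable [MeasurableSpace X] [MetricSpace M] [CompactSpace M]
  [MeasurableSpace M] [BorelSpace M] {P : Measure X} {θ : X → X} {f : X → M → M} {ℓ : X → M → ℝ}
  {A : X → Set M} {σ L : X → ℝ} {q : X → ℕ} {δ : ℝ} {α : ℝ≥0} {φ : X → M → ℝ} {ε : ℝ}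
  {m : ℝ≥0} {γ : ℝ} {ν : Kernel X M}

/-- The function 𝓛_w 1 is a sum of deg(f_w) weights, which differ from e^{inf φ_w} by a factor at
most 2 because ε(diam M)^α ≤ γ < 1. -/
theorem eigenvalue_mem_Icc [ConnectedSpace M] (hM : IsGeodesicSpace M) (hδ : 0 < δ)
    (hf : GeneratingMaps θ f ℓ A σ L q δ) (hα : 0 < α)
    (hφ : SmallVariationPotential P f q α φ ε) (hm : 1 ≤ m) (hγ : γ < 1) {w : X}
    (hcone : coneRate f σ L q α ε m w ≤ γ) [IsMarkovKernel ν] :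
    eigenvalue θ f φ ν w ∈ Icc (mapDegree (f w) * Real.exp (⨅ x, φ w x))
      (mapDegree (f w) * (Real.exp (⨅ x, φ w x) * 2)) := by
  obtain ⟨-, hr, hD⟩ := hf.rates_le (α := α) hφ.pos hm hγ hcone
  have hγ0 : 0 ≤ γ := by
    have h1 := hφ.pos
    have h2 := hf.one_le_L w
    exact le_trans (by positivity) hr
  have hbd : ∀ x, transferOp (f w) (φ w) (fun _ => 1) x ∈
      Icc (mapDegree (f w) * Real.exp (⨅ x, φ w x))
        (mapDegree (f w) * (Real.exp (⨅ x, φ w x) * 2)) := by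
    intro x
    have := transferOp_one_mem_Icc (hf.finite_fiber w x) (u := φ w)
      (a := Real.exp (⨅ x, φ w x)) (b := Real.exp (⨅ x, φ w x) * 2) fun y => by
        have h1 := hφ.exp_mem_Icc hα w y
        refine ⟨h1.1, h1.2.trans ?_⟩
        gcongr
        linarith
    rwa [hf.ncard_fiber hM hδ] at this
  have hholder : HolderInBalls δ
      (mapDegree (f w) * (Real.exp (⨅ x, φ w x) * γ).toNNReal) α
      (transferOp (f w) (φ w) fun _ => 1) := by
    intro x y hy
    have h1 := abs_transferOp_sub_le hM hδ hf hα hφ hm hγ hcone (C := 0) (S := 1)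
      (ψ := fun _ => 1) (fun x y _ => by simp) (fun x => by simp) hy
    refine h1.trans (le_of_eq ?_)
    push_cast [Real.coe_toNNReal _ (mul_nonneg (Real.exp_pos _).le hγ0)]
    ring
  have hint := integrable_of_holderInBalls hδ hα hholder (μ := ν (θ w))
  have h1 := integral_mono (integrable_const _) hint fun x => (hbd x).1
  have h2 := integral_mono hint (integrable_const _) fun x => (hbd x).2
  simp only [integral_const, probReal_univ, smul_eq_mul, one_mul] at h1 h2
  exact ⟨h1, h2⟩

/-- The normalized transfer operators are mixing over any invariant set on which the conformal
measures satisfy their equation and the exactness is uniform. -/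
theorem mixingOperators_normalizedTransfer [ConnectedSpace M] (hM : IsGeodesicSpace M) (hδ : 0 < δ)
    (hf : GeneratingMaps θ f ℓ A σ L q δ) (hα : 0 < α)
    (hφ : SmallVariationPotential P f q α φ ε) (hm : 1 ≤ m) (hγ : γ < 1) (hγ0 : 0 ≤ γ)
    (hcone : ∀ w, coneRate f σ L q α ε m w ≤ γ) [IsMarkovKernel ν] {G : Set X}
    (hG : MapsTo θ G G)
    (href : ∀ w ∈ G, ∀ ψ : M → ℝ, Continuous ψ →
      ∫ x, transferOp (f w) (φ w) ψ x ∂(ν (θ w)) = eigenvalue θ f φ ν w * ∫ x, ψ x ∂(ν w))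
    {N : ℕ → ℕ} (hN : ∀ i, 0 < N i)
    (hex : ∀ i : ℕ, ∀ w ∈ G, ∀ x z, ∃ y ∈ Metric.ball x (1 / ((i : ℝ) + 1)),
      fiberIter θ f (N i) w y = z) {d : ℕ} (hd : ∀ w, mapDegree (f w) ≤ d) :
    MixingOperators θ f (normalizedTransfer θ f hf.finite_fiber φ ν) (fun w => ν w) G δ α
      γ.toNNReal (2 * d + 1) N := by
  have hpos : ∀ w, (0 : ℝ) < mapDegree (f w) := fun w => by
    have := hf.q_lt_degree w
    exact_mod_cast (by omega : 0 < mapDegree (f w))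
  have hev := fun w => eigenvalue_mem_Icc (ν := ν) hM hδ hf hα hφ hm hγ (hcone w)
  have hevpos : ∀ w, 0 < eigenvalue θ f φ ν w := fun w =>
    (mul_pos (hpos w) (Real.exp_pos _)).trans_le (hev w).1
  refine ⟨hG, fun w _ => inferInstance, fun w _ => hf.surjective hM hδ w, ?_, ?_, ?_, hN, hex⟩
  · intro w _ u hu y
    rw [normalizedTransfer_apply]
    have h1 := le_transferOp (hf.finite_fiber w (f w y)) (φ w) hu
    have h2 := (hφ.exp_mem_Icc hα w y).1
    have h3 : Real.exp (⨅ x, φ w x) * u y ≤ transferOp (f w) (φ w) u (f w y) :=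
      (mul_le_mul_of_nonneg_right h2 (hu y)).trans h1
    have h4 : eigenvalue θ f φ ν w ≤ (2 * d + 1) * Real.exp (⨅ x, φ w x) := by
      have h5 : (mapDegree (f w) : ℝ) ≤ d := by exact_mod_cast hd w
      have h6 := Real.exp_pos (⨅ x, φ w x)
      nlinarith [(hev w).2]
    push_cast
    rw [← mul_assoc, mul_comm _ (eigenvalue θ f φ ν w)⁻¹, mul_assoc,
      le_inv_mul_iff₀ (hevpos w)]
    calc eigenvalue θ f φ ν w * u y ≤ (2 * d + 1) * Real.exp (⨅ x, φ w x) * u y :=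
          mul_le_mul_of_nonneg_right h4 (hu y)
      _ = (2 * d + 1) * (Real.exp (⨅ x, φ w x) * u y) := by ring
      _ ≤ _ := by gcongr
  · intro w _ C S u hu hS x y hy
    have h1 := abs_transferOp_sub_le hM hδ hf hα hφ hm hγ (hcone w) hu hS hy
    rw [normalizedTransfer_apply, normalizedTransfer_apply, ← mul_sub, abs_mul,
      abs_of_pos (inv_pos.2 (hevpos w)), inv_mul_le_iff₀ (hevpos w)]
    push_cast [Real.coe_toNNReal _ hγ0]
    refine h1.trans ?_
    rw [mul_assoc]
    have := (hev w).1
    gcongr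
  · intro w hw C u hu
    simp only [normalizedTransfer_apply]
    rw [integral_const_mul, href w hw u (hu.continuous hδ hα), inv_mul_cancel_left₀ (hevpos w).ne']

/-- The push-forward of a measure with Hölder density with respect to the conformal measure. -/
theorem map_fiberIter_withDensity (hδ : 0 < δ) (hα : 0 < α) [IsMarkovKernel ν]
    (hfc : ∀ w, Continuous (f w)) {hfin : ∀ w x, (f w ⁻¹' {x}).Finite} {G : Set X} {γ B : ℝ≥0}
    {N : ℕ → ℕ}
    (H : MixingOperators θ f (normalizedTransfer θ f hfin φ ν) (fun w => ν w) G δ α γ B N)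
    (hB : 0 < B) (hev : ∀ w ∈ G, eigenvalue θ f φ ν w ≠ 0)
    (href : ∀ w ∈ G, ∀ ψ : M → ℝ, Continuous ψ →
      ∫ x, transferOp (f w) (φ w) ψ x ∂(ν (θ w)) = eigenvalue θ f φ ν w * ∫ x, ψ x ∂(ν w))
    {w : X} (hw : w ∈ G) {C : ℝ≥0} {u : M → ℝ} (hu0 : ∀ x, 0 ≤ u x)
    (hu : HolderInBalls δ C α u) (n : ℕ) :
    ((ν w).withDensity fun x => ENNReal.ofReal (u x)).map (fiberIter θ f n w) =
      (ν (θ^[n] w)).withDensity fun x => ENNReal.ofReal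
        (opIter θ (normalizedTransfer θ f hfin φ ν) n w u x) := by
  induction n with
  | zero => exact Measure.map_id
  | succ n ih =>
    obtain ⟨C', hC'⟩ := H.exists_holder_opIter hδ hα hw hu n
    obtain ⟨C'', hC''⟩ := H.exists_holder_opIter hδ hα hw hu (n + 1)
    have hv0 := H.opIter_nonneg hB hw hu0 n
    have hv0' := H.opIter_nonneg hB hw hu0 (n + 1)
    have hwn := H.iterate_mem hw n
    have hcomp : fiberIter θ f (n + 1) w = f (θ^[n] w) ∘ fiberIter θ f n w := rfl
    rw [hcomp, ← Measure.map_map (hfc _).measurable (continuous_fiberIter hfc n w).measurable, ih]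
    have hc := hC'.continuous hδ hα
    have hc' := hC''.continuous hδ hα
    have := isFiniteMeasure_withDensity_of_continuous (μ := ν (θ^[n] w)) hc
    have := isFiniteMeasure_withDensity_of_continuous (μ := ν (θ^[n + 1] w)) hc'
    -- Conformality is only given for continuous functions. Testing on continuous `g` identifies the
    -- measures, which then covers every integrable observable.
    refine ext_of_forall_integral_eq_of_IsFiniteMeasure fun g => ?_
    rw [integral_map (hfc _).measurable.aemeasurable
      g.continuous.measurable.aestronglyMeasurable, integral_withDensity_ofReal hc hv0,
      integral_withDensity_ofReal hc' hv0', Function.iterate_succ_apply', opIter_succ_apply]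
    have h1 := href _ hwn (fun y => g (f (θ^[n] w) y) *
      opIter θ (normalizedTransfer θ f hfin φ ν) n w u y)
      ((g.continuous.comp (hfc _)).mul hc)
    simp only [transferOp_comp_mul (hfin _)] at h1
    simp only [normalizedTransfer_apply]
    have h2 : ∀ x, (eigenvalue θ f φ ν (θ^[n] w))⁻¹ * transferOp (f (θ^[n] w)) (φ (θ^[n] w))
        (opIter θ (normalizedTransfer θ f hfin φ ν) n w u) x * g x =
        (eigenvalue θ f φ ν (θ^[n] w))⁻¹ * (g x * transferOp (f (θ^[n] w)) (φ (θ^[n] w))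
        (opIter θ (normalizedTransfer θ f hfin φ ν) n w u) x) := fun x => by ring
    simp only [h2]
    rw [integral_const_mul, h1, inv_mul_cancel_left₀ (hev _ hwn)]
    simp only [mul_comm]

end NormalizedTransfer

/-! ### Decay of correlations. -/

theorem theoremB {X M : Type*} [MeasurableSpace X]
    [MetricSpace M] [CompactSpace M] [ConnectedSpace M] [MeasurableSpace M] [BorelSpace M]
    (hM : IsGeodesicSpace M)
    (P : Measure X) [IsProbabilityMeasure P] (θ : X ≃ᵐ X) (hθ : Ergodic θ P)
    (f : X → M → M) (ℓ : X → M → ℝ) (A : X → Set M) (σ L : X → ℝ) (q : X → ℕ)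
    (δ : ℝ) (hδ : 0 < δ) (hf : GeneratingMaps θ f ℓ A σ L q δ)
    (α : ℝ≥0) (hα : 0 < α) (φ : X → M → ℝ) (ε : ℝ)
    (hφ : SmallVariationPotential P f q α φ ε)
    (m : ℝ≥0) (hm : 1 ≤ m)
    (hm_holder : ∀ (C : ℝ≥0) (u : M → ℝ), HolderInBalls δ C α u → HolderWith (C * m) α u)
    (γ : ℝ) (hγ : γ < 1) (hcone : ∀ w, coneRate f σ L q α ε m w ≤ γ)
    (ν : Kernel X M) (hν : IsReferenceFamily P θ f φ ν)
    (h : X → M → ℝ) (hh : IsInvariantDensity P θ f φ α ν h) :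
    ∃ τ : ℝ, 0 < τ ∧ τ < 1 ∧ ∀ᵐ w ∂P, ∀ ψ : M → ℝ, MemHolder α ψ →
      ∃ K : ℝ, 0 < K ∧ ∀ n : ℕ, 1 ≤ n → ∀ g : M → ℝ,
        Integrable g (fiberMeasure ν h (θ^[n] w)) →
        Integrable (fun x => g (fiberIter θ f n w x) * ψ x) (fiberMeasure ν h w) ∧
        |∫ x, g (fiberIter θ f n w x) * ψ x ∂(fiberMeasure ν h w) -
            (∫ x, g x ∂(fiberMeasure ν h (θ^[n] w))) * ∫ x, ψ x ∂(fiberMeasure ν h w)| ≤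
          K * (∫ x, |g x| ∂(fiberMeasure ν h (θ^[n] w))) * τ ^ n := by

  obtain ⟨hmarkov, href⟩ := hν
  obtain ⟨-, hdens⟩ := hh
  obtain ⟨d, hd⟩ := hf.degree_bdd
  have hγ0 : 0 ≤ γ := by
    obtain ⟨w⟩ := nonempty_of_isProbabilityMeasure P
    obtain ⟨-, hr, -⟩ := hf.rates_le (α := α) hφ.pos hm hγ (hcone w)
    have h1 := hφ.pos
    have h2 := hf.one_le_L w
    exact le_trans (by positivity) hr
  have hfc : ∀ w, Continuous (f w) := fun w => (hf.isLocalHomeomorph w).continuous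
  have hevpos : ∀ w, eigenvalue θ f φ ν w ≠ 0 := by
    intro w
    have h1 : (0 : ℝ) < mapDegree (f w) := by
      have := hf.q_lt_degree w
      exact_mod_cast (by omega : 0 < mapDegree (f w))
    exact ((mul_pos h1 (Real.exp_pos _)).trans_le
      (eigenvalue_mem_Icc hM hδ hf hα hφ hm hγ (hcone w)).1).ne'
  choose N hN hNex using fun i : ℕ => hf.exists_uniform_exact (P := P) hM hδ hθ
    (Nat.one_div_pos_of_nat (n := i) (α := ℝ))
  have hgood := (href.and hdens).and (ae_all_iff.2 hNex)
  obtain ⟨G, hGae, hG, hGmem⟩ := hθ.toMeasurePreserving.exists_mapsTo_of_ae hgood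
  have H := mixingOperators_normalizedTransfer (ν := ν) hM hδ hf hα hφ hm hγ hγ0 hcone hG
    (fun w hw => (hGmem w hw).1.1) hN (fun i w hw => (hGmem w hw).2 i) hd
  have hB : (1 : ℝ≥0) ≤ 2 * d + 1 := le_add_self
  have hB0 : (0 : ℝ≥0) < 2 * d + 1 := zero_lt_one.trans_le hB
  obtain ⟨τ, hτ0, hτ1, hrate⟩ := H.exists_rate hδ hα hB (Real.toNNReal_lt_one.2 hγ)
  refine ⟨τ, hτ0, hτ1, ?_⟩
  filter_upwards [hGae] with w hw ψ hψ
  set T := normalizedTransfer θ f hf.finite_fiber φ ν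
  obtain ⟨hhol, ⟨c, C, hc, hcC⟩, -, hint⟩ := (hGmem w hw).1.2
  have hhc : ∀ w ∈ G, Continuous (h w) := fun w hw =>
    (hGmem w hw).1.2.1.holderWith.continuous hα
  have hh0 : ∀ w ∈ G, ∀ x, 0 < h w x := fun w hw x => by
    obtain ⟨-, ⟨c, C, hc, hcC⟩, -⟩ := (hGmem w hw).1.2
    exact hc.trans_le (hcC x).1
  have hiter : ∀ n, opIter θ T n w (h w) = h (θ^[n] w) := by
    intro n
    induction n with
    | zero => rfl
    | succ n ih =>
      funext x
      rw [opIter_succ_apply, ih, normalizedTransfer_apply,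
        (hGmem _ (H.iterate_mem hw n)).1.2.2.2.1 x, Function.iterate_succ_apply',
        inv_mul_cancel_left₀ (hevpos _)]
  have hψc := hψ.holderWith.continuous hα
  obtain ⟨R, hR⟩ := exists_abs_le_of_continuous hψc
  obtain ⟨R', hR'⟩ := exists_abs_le_of_continuous (hhc w hw)
  have hh := hhol.holderWith.holderInBalls δ
  -- Shifting `ψ` by a bound `R` makes the density nonnegative; the contribution of `R` to the
  -- correlation vanishes because μ_w is carried to μ_{θ^n(w)}.
  set u : M → ℝ := fun x => h w x * (ψ x + R) with hu
  have hu0 : ∀ x, 0 ≤ u x := fun x =>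
    mul_nonneg (hh0 w hw x).le (by linarith [(abs_le.1 (hR x)).1])
  obtain ⟨Cu, huh⟩ : ∃ C, HolderInBalls δ C α u := by
    have h1 := (hψ.holderWith.holderInBalls δ).affine R 1
    obtain ⟨S, hS⟩ := exists_abs_le_of_continuous (h1.continuous hδ hα)
    have h2 := hh.mul h1 hR' hS
    simp only [NNReal.coe_one, one_mul] at h2
    exact ⟨_, h2⟩
  obtain ⟨K, hK, hKn⟩ := hrate w hw (h w) ⟨_, hh⟩ ⟨c, hc, fun x => (hcC x).1⟩ hint u hu0 ⟨_, huh⟩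
  refine ⟨K, hK, fun n _ g hg => ?_⟩
  have hwn := H.iterate_mem hw n
  have hg' : Integrable g (ν (θ^[n] w)) :=
    integrable_of_withDensity_ofReal (hhc _ hwn) (hh0 _ hwn) hg
  have hFm := (continuous_fiberIter (θ := θ) hfc n w).measurable
  have hmaph : (fiberMeasure ν h w).map (fiberIter θ f n w) = fiberMeasure ν h (θ^[n] w) := by
    have := map_fiberIter_withDensity hδ hα hfc H hB0 (fun w _ => hevpos w)
      (fun w hw => (hGmem w hw).1.1) hw (fun x => (hh0 w hw x).le) hh n
    rw [hiter] at this
    exact this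
  have hmapu := map_fiberIter_withDensity hδ hα hfc H hB0 (fun w _ => hevpos w)
      (fun w hw => (hGmem w hw).1.1) hw hu0 huh n
  have hgF : Integrable (fun x => g (fiberIter θ f n w x)) (fiberMeasure ν h w) := by
    rw [← hmaph] at hg
    exact (integrable_map_measure hg.aestronglyMeasurable hFm.aemeasurable).1 hg
  have hgF' : Integrable (fun x => g (fiberIter θ f n w x)) (ν w) :=
    integrable_of_withDensity_ofReal (hhc _ hw) (hh0 _ hw) hgF
  have huc := huh.continuous hδ hα
  obtain ⟨C', hC'⟩ := H.exists_holder_opIter hδ hα hw huh n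
  have hunc := hC'.continuous hδ hα
  have hun0 := H.opIter_nonneg hB0 hw hu0 n
  set v := opIter θ T n w u
  set I := ∫ x, u x ∂(ν w) with hI
  refine ⟨(hgF.continuous_mul hψc).congr (Filter.Eventually.of_forall fun x => mul_comm _ _), ?_⟩
  have e1 : ∫ x, u x * g (fiberIter θ f n w x) ∂(ν w) = ∫ x, v x * g x ∂(ν (θ^[n] w)) := by
    rw [← integral_withDensity_ofReal huc hu0, ← integral_withDensity_ofReal hunc hun0, ← hmapu,
      integral_map hFm.aemeasurable]
    rw [hmapu]
    exact hg'.aestronglyMeasurable.mono_ac (withDensity_absolutelyContinuous _ _)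
  have e2 : ∫ x, h w x * g (fiberIter θ f n w x) ∂(ν w) =
      ∫ x, h (θ^[n] w) x * g x ∂(ν (θ^[n] w)) := by
    rw [← integral_withDensity_ofReal (hhc w hw) fun x => (hh0 w hw x).le,
      ← integral_withDensity_ofReal (hhc _ hwn) fun x => (hh0 _ hwn x).le]
    change ∫ x, g (fiberIter θ f n w x) ∂(fiberMeasure ν h w) =
      ∫ x, g x ∂(fiberMeasure ν h (θ^[n] w))
    rw [← hmaph, integral_map hFm.aemeasurable]
    rw [hmaph]
    exact hg.aestronglyMeasurable
  have e3 : ∀ (w') (_ : w' ∈ G) (k : M → ℝ), ∫ x, k x ∂(fiberMeasure ν h w') =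
      ∫ x, h w' x * k x ∂(ν w') := fun w' hw' k =>
    integral_withDensity_ofReal (hhc w' hw') (fun x => (hh0 w' hw' x).le) k
  rw [e3 w hw, e3 w hw, e3 _ hwn, e3 _ hwn]
  have e4 : ∫ x, h w x * (g (fiberIter θ f n w x) * ψ x) ∂(ν w) =
      ∫ x, v x * g x ∂(ν (θ^[n] w)) - R * ∫ x, h (θ^[n] w) x * g x ∂(ν (θ^[n] w)) := by
    rw [← e1, ← e2, ← integral_const_mul, ← integral_sub (hgF'.continuous_mul huc)
      ((hgF'.continuous_mul (hhc w hw)).const_mul _)]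
    congr 1
    funext x
    simp only [hu]
    ring
  have e5 : ∫ x, h w x * ψ x ∂(ν w) = I - R := by
    have i1 : Integrable (h w) (ν w) := integrable_of_holderInBalls hδ hα hh
    have i2 : Integrable (fun x => h w x * ψ x) (ν w) :=
      (i1.continuous_mul hψc).congr (Filter.Eventually.of_forall fun x => mul_comm _ _)
    have : I = ∫ x, (h w x * ψ x + R * h w x) ∂(ν w) := by
      rw [hI]
      congr 1
      funext x
      simp only [hu]
      ring
    rw [this, integral_add i2 (i1.const_mul _), integral_const_mul, hint]
    ring
  have i3 := hg'.continuous_mul hunc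
  have i4 := hg'.continuous_mul (hhc _ hwn)
  have e6 : ∫ x, v x * g x ∂(ν (θ^[n] w)) - R * ∫ x, h (θ^[n] w) x * g x ∂(ν (θ^[n] w)) -
      (∫ x, h (θ^[n] w) x * g x ∂(ν (θ^[n] w))) * (I - R) =
      ∫ x, (v x - I * h (θ^[n] w) x) * g x ∂(ν (θ^[n] w)) := by
    have : ∀ x, (v x - I * h (θ^[n] w) x) * g x = v x * g x - I * (h (θ^[n] w) x * g x) :=
      fun x => by ring
    simp only [this]
    rw [integral_sub i3 (i4.const_mul _), integral_const_mul]
    ring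
  rw [e4, e5, e6, mul_right_comm, ← integral_const_mul]
  have i5 := (hg'.abs.continuous_mul (hhc _ hwn)).const_mul (K * τ ^ n)
  -- The error is relative to the density `h (θ^[n] w)`, so the integral of |g| against μ_{θ^n(w)}
  -- appears with no further constant.
  refine (abs_integral_le_integral_abs).trans (integral_mono_of_nonneg
    (Filter.Eventually.of_forall fun x => abs_nonneg _) i5 (Filter.Eventually.of_forall fun x => ?_))
  have h1 := hKn n x
  rw [hiter] at h1
  simp only [abs_mul]
  rw [← mul_assoc]
  gcongr
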